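/- Let $\Gamma$ be a finite tree with a distinguished unframed vertex $v_0$, whose other vertices $v$ carry integer framings $e_v$. Let $G=\Gamma-v_0$, with vertices $v_1,\dots,v_s$, and equip the lattice $L=\mathbb{Z}^s=H_2(X(G);\mathbb{Z})$, with basis the vertices of $G$, with the intersection form given by $v\cdot v=e_v$, $v\cdot w=1$ if $v\neq w$ are adjacent in $G$, and $v\cdot w=0$ otherwise. Assume that this form is negative definite. A vertex $v$ of $G$ is called bad if $\deg_G(v)>-e_v$. Let $v_0^*\in\mathrm{Hom}(L,\mathbb{Z})$ be defined by $v_0^*(v)=1$ if $v$ is adjacent to $v_0$ in $\Gamma$ and $v_0^*(v)=0$ otherwise. Let $\mathfrak{s}$ be a $\mathrm{Spin}^c$ structure on the plumbed three-manifold $Y(G)$, and let $k\in\mathrm{Hom}(L,\mathbb{Z})$ be a characteristic vector (that is, $k(x)\equiv x\cdot x \pmod 2$ for all $x\in L$) representing $\mathfrak{s}$. For a characteristic vector $k'$ put $\chi_{k'}(x)=-\tfrac12\left(k'(x)+x\cdot x\right)$. Decompose $\mathbb{R}^s$ into the cubes $\Box=(\ell,I)$, $\ell\in L$, $I\subseteq\{v_1,\dots,v_s\}$,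 where $(\ell,I)$ is the convex hull of the points $\ell+\sum_{v\in J}v$, $J\subseteq I$. Let $w_{k'}(\Box)$ be the maximum of $\chi_{k'}$ over these points. For $t\in[0,2]$ set \[ w_t(\Box)=(2-t)\,w_k(\Box)+t\,w_{k+2v_0^*}(\Box),\qquad M_l=\bigcup_{w_t(\Box)\le l}\Box\quad(l\in\mathbb{R}), \] and define the reduced deformed lattice homology in degree $p\ge 0$ by \[ t\mathbb{HFK}_{\mathrm{red},p}(\Gamma,\mathfrak{s})=\prod_{l\in\mathbb{R}}\widetilde H_p(M_l;\mathbb{F}), \] where $\mathbb{F}=\mathbb{Z}/2\mathbb{Z}$ and $\widetilde H_p$ is the reduced cellular homology, i.e. the degree $p\geq 0$ homology of the cellular chain complex augmented by the map sending each $0$-cell to $1\in\mathbb{F}$ (so it is zero if $M_l=\emptyset$). If $G$ has at most $n$ bad vertices ($n\ge 0$), then for every $t\in[0,2]$, every $\mathrm{Spin}^c$ structure $\mathfrak{s}$ on $Y(G)$, every characteristic vector $k$ representing $\mathfrak{s}$, and every integer $p\ge n$, \[ t\mathbb{HFK}_{\mathrm{red},p}(\Gamma,\mathfrak{s})=0 .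 \] -/

import Mathlib

/-- A plumbing diagram of a graph knot: a finite tree `Γ` with one unframed vertex `root`
(usually written `v₀`), all other vertices carrying an integer framing. -/
structure KnotPlumbing (V : Type*) [Fintype V] [DecidableEq V] where
  graph : SimpleGraph V
  isTree : graph.IsTree
  root : V
  framing : {v : V // v ≠ root} → ℤ

namespace KnotPlumbing

variable {V : Type*} [Fintype V] [DecidableEq V] (Γ : KnotPlumbing V)

/-- The vertices of the framed plumbing graph `G = Γ - v₀`. -/
abbrev Vert : Type _ := {v : V // v ≠ Γ.root}

/-- The framed plumbing graph `G = Γ - v₀`. -/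
def framedGraph : SimpleGraph Γ.Vert := Γ.graph.induce {v | v ≠ Γ.root}

/-- The lattice `H₂(X(G); ℤ) = ℤ^s`, with basis the vertices of `G`. -/
abbrev Lattice : Type _ := Γ.Vert → ℤ

open scoped Classical in
/-- The intersection form of `X(G)`. -/
noncomputable def inter (x y : Γ.Lattice) : ℤ :=
  (∑ v, Γ.framing v * x v * y v) +
    ∑ v, ∑ w, if Γ.framedGraph.Adj v w then x v * y w else 0

/-- The intersection form of `X(G)` is negative definite. -/
def NegativeDefinite : Prop := ∀ x : Γ.Lattice, x ≠ 0 → Γ.inter x x < 0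

/-- A vertex `v` of `G` is bad if `deg v > - v²`, with the degree taken in `G`. -/
def IsBad (v : Γ.Vert) : Prop :=
  -Γ.framing v < ((Γ.framedGraph.neighborSet v).ncard : ℤ)

/-- The number of bad vertices of `G`. -/
noncomputable def numBad : ℕ := {v : Γ.Vert | Γ.IsBad v}.ncard

/-- Cohomology classes `k ∈ H²(X(G); ℤ) = Hom(H₂(X(G); ℤ), ℤ)`. -/
abbrev Cohomology : Type _ := Module.Dual ℤ Γ.Lattice

/-- Characteristic vectors of the intersection form. -/
def IsCharacteristic (k : Γ.Cohomology) : Prop :=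
  ∀ x : Γ.Lattice, k x ≡ Γ.inter x x [ZMOD 2]

open scoped Classical in
/-- The class `v₀^*`: its value on a vertex `v` of `G` is `1` if `v` is adjacent to `v₀` in `Γ`,
and `0` otherwise. -/
noncomputable def rootDual : Γ.Cohomology :=
  ∑ v : Γ.Vert, if Γ.graph.Adj Γ.root v then LinearMap.proj v else 0

/-- The Riemann-Roch function `χ_k(x) = -(k(x) + x²) / 2`. -/
noncomputable def chi (k : Γ.Cohomology) (x : Γ.Lattice) : ℝ :=
  -(((k x + Γ.inter x x : ℤ) : ℝ) / 2)

/-- The cells of the cubical decomposition of `ℝ^s`: the pair `(ℓ, I)` is the cube with vertices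
`ℓ + ∑_{v ∈ J} v` for `J ⊆ I`. -/
abbrev Cell : Type _ := Γ.Lattice × Finset Γ.Vert

/-- The lattice point `ℓ + ∑_{v ∈ J} v`. -/
def corner (ℓ : Γ.Lattice) (J : Finset Γ.Vert) : Γ.Lattice :=
  ℓ + ∑ v ∈ J, Pi.single v 1

/-- `w_k(□)`, the maximum of `χ_k` over the vertices of the cell. -/
noncomputable def weight (k : Γ.Cohomology) (c : Γ.Cell) : ℝ :=
  c.2.powerset.sup' ⟨∅, Finset.empty_mem_powerset _⟩ fun J => Γ.chi k (Γ.corner c.1 J)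

/-- `w_t(□) = (2 - t) w_k(□) + t w_{k + 2 v₀^*}(□)`. -/
noncomputable def deformedWeight (k : Γ.Cohomology) (t : ℝ) (c : Γ.Cell) : ℝ :=
  (2 - t) * Γ.weight k c + t * Γ.weight (k + 2 • Γ.rootDual) c

/-- All finite cellular chains of `ℝ^s` with coefficients in the field with two elements. -/
abbrev Chain : Type _ := Γ.Cell →₀ ZMod 2

noncomputable instance : AddCommGroup Γ.Chain :=
  inferInstanceAs (AddCommGroup (Γ.Cell →₀ ZMod 2))

/-- The cellular boundary: the sum of the codimension one faces. -/
noncomputable def boundary : Γ.Chain →ₗ[ZMod 2] Γ.Chain :=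
  Finsupp.linearCombination (ZMod 2) fun c : Γ.Cell =>
    ∑ v ∈ c.2, (Finsupp.single (c.1, c.2.erase v) (1 : ZMod 2) +
      Finsupp.single (c.1 + Pi.single v 1, c.2.erase v) (1 : ZMod 2))

/-- The augmentation: the sum of the coefficients (used on `0`-chains). -/
noncomputable def augmentation : Γ.Chain →ₗ[ZMod 2] ZMod 2 :=
  Finsupp.linearCombination (ZMod 2) fun _ : Γ.Cell => (1 : ZMod 2)

/-- `C_p(M_l; 𝔽)`: the `p`-chains of the sub-level set `M_l = ⋃_{w_t(□) ≤ l} □`. -/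
def sublevelChains (k : Γ.Cohomology) (t l : ℝ) (p : ℕ) : Submodule (ZMod 2) Γ.Chain :=
  Finsupp.supported (ZMod 2) (ZMod 2) {c | c.2.card = p ∧ Γ.deformedWeight k t c ≤ l}

/-- The cycles of degree `p` of the augmented cellular complex of `M_l`. -/
noncomputable def reducedCycles (k : Γ.Cohomology) (t l : ℝ) :
    ℕ → Submodule (ZMod 2) Γ.Chain
  | 0 => Γ.sublevelChains k t l 0 ⊓ LinearMap.ker Γ.augmentation
  | p + 1 => Γ.sublevelChains k t l (p + 1) ⊓ LinearMap.ker Γ.boundary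

/-- The boundaries of degree `p` of the cellular complex of `M_l`. -/
noncomputable def boundaries (k : Γ.Cohomology) (t l : ℝ) (p : ℕ) :
    Submodule (ZMod 2) Γ.Chain :=
  (Γ.sublevelChains k t l (p + 1)).map Γ.boundary

/-- The reduced cellular homology group `H̃_p(M_l; 𝔽)`, for `p ≥ 0`. -/
abbrev ReducedHomology (k : Γ.Cohomology) (t l : ℝ) (p : ℕ) : Type _ :=
  Γ.reducedCycles k t l p ⧸ (Γ.boundaries k t l p).submoduleOf (Γ.reducedCycles k t l p)

/-- The reduced deformed lattice homology group `∏_{l ∈ ℝ} H̃_p(M_l; 𝔽)` in degree `p`, for the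
`Spin^c` structure of `Y(G)` represented by the characteristic vector `k`. -/
abbrev ReducedLatticeHomology (k : Γ.Cohomology) (t : ℝ) (p : ℕ) : Type _ :=
  ∀ l : ℝ, Γ.ReducedHomology k t l p

end KnotPlumbing

/-!
Fix a level `l`, and let `B` be the set of bad vertices. The cells `(ℓ, I)` of `M_l` are sorted
into fibres according to the set `D = I ∩ B` and the coordinates of `ℓ` in the directions of `B`.
The point is that in each fibre the complex formed with the boundary in the directions outside `B`
has no reduced homology (`CubicalLattice.exists_bounding_chain_of_boxCollapse` together with
`RootedForest.exists_boxCollapse`). Granting this, a `p`-cycle with `p ≥ |B|` is pushed, by adding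
boundaries, into cells with fewer and fewer directions in `B`, until nothing is left
(`CubicalLattice.exists_bounding_chain`). The augmentation of a fibre matters only if
`p = |B|` and `D = B`; there the sum of the coefficients vanishes because the cycle projects to a
finite cycle of dimension `|B|` in `ℝ^B`, and such a cycle is zero
(`CubicalLattice.coeffSumOn_eq_zero_of_cycle`).

That the fibres are acyclic is shown by shrinking a large box to a point, in steps that remove one
face of the box and along which neither of the two maxima in the deformed weight increases
(`CubicalLattice.BoxCollapse`). Treating the two maxima simultaneously avoids any discussion of
the parameter `t`. Both Riemann-Roch functions are of the form
`∑ v, (φ v (x v) - x v * x (parent of v))` for the rooted tree `Γ`, with the value `0`, respectively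
`1`, at the root. There are three kinds of steps.

* As in Laufer's algorithm, the lower end of the box is raised in a direction outside `B` with
  nonpositive slope until all these slopes are positive, say at `m`
  (`RootedForest.boxCollapse_of_lower`). Negative definiteness guarantees that this stops.
* Since no vertex outside `B` is bad, the upper end can be lowered to `m + 1`
  (`RootedForest.boxCollapse_of_upper`).
* In the remaining unit cube the directions are treated from the leaves to the root. When the
  coordinates at the proper descendants of `v` are already fixed, the rest of the tree acts on the
  increments in the direction `v` only through the parent of `v`, so these increments vary by at
  most one (`RootedForest.cellMax_energy_increment_le`). As they are integers, they do not change
  sign, and the direction `v` can be collapsed (`RootedForest.boxCollapse_of_cube`).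
-/

/-! ### Cubical chains of a lattice -/

namespace CubicalLattice

open Finsupp

/-- The cells of the decomposition of `ℝ^ι` into unit cubes: `(ℓ, I)` is the cube with lowest
vertex `ℓ` and edge directions `I`. -/
abbrev Cell (ι : Type*) : Type _ := (ι → ℤ) × Finset ι

/-- Finite cubical chains with coefficients in the field with two elements. -/
abbrev Chain (ι : Type*) : Type _ := Cell ι →₀ ZMod 2

variable {ι : Type*}

/-- The sum of the coefficients of a chain. -/
noncomputable def coeffSum : Chain ι →ₗ[ZMod 2] ZMod 2 :=
  Finsupp.linearCombination (ZMod 2) fun _ : Cell ι => (1 : ZMod 2)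

theorem coeffSum_single (c : Cell ι) : coeffSum (single c 1) = 1 := by
  simp [coeffSum]

variable [DecidableEq ι]

/-- The part of the cubical boundary that consists of the faces in the directions outside `S`. -/
noncomputable def partialBoundary (S : Finset ι) : Chain ι →ₗ[ZMod 2] Chain ι :=
  Finsupp.linearCombination (ZMod 2) fun c : Cell ι =>
    ∑ v ∈ c.2 \ S, (Finsupp.single (c.1, c.2.erase v) (1 : ZMod 2) +
      Finsupp.single (c.1 + Pi.single v 1, c.2.erase v) (1 : ZMod 2))

theorem partialBoundary_single (S : Finset ι) (c : Cell ι) :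
    partialBoundary S (single c 1) = ∑ v ∈ c.2 \ S, (single (c.1, c.2.erase v) (1 : ZMod 2) +
      single (c.1 + Pi.single v 1, c.2.erase v) (1 : ZMod 2)) := by
  simp [partialBoundary]

theorem sum_symm_eq_zero {M : Type*} [AddCommGroup M] [Module (ZMod 2) M] (s : Finset ι)
    (T : ι → ι → M) (hT : ∀ v w, T v w = T w v) : ∑ v ∈ s, ∑ w ∈ s.erase v, T v w = 0 := by
  rw [Finset.sum_sigma']
  refine Finset.sum_involution (fun a _ => ⟨a.2, a.1⟩) ?_ ?_ ?_ ?_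
  · rintro ⟨v, w⟩ _
    rw [hT w v]
    exact ZModModule.add_self _
  · rintro ⟨v, w⟩ h _ h'
    simp only [Finset.mem_sigma, Finset.mem_erase] at h
    simp only [Sigma.mk.injEq] at h'
    exact h.2.1 h'.1
  · rintro ⟨v, w⟩ h
    simp only [Finset.mem_sigma, Finset.mem_erase] at h ⊢
    exact ⟨h.2.2, fun e => h.2.1 e.symm, h.1⟩
  · rintro ⟨v, w⟩ _
    rfl

theorem partialBoundary_partialBoundary (S : Finset ι) (z : Chain ι) :
    partialBoundary S (partialBoundary S z) = 0 := by
  suffices h : partialBoundary S ∘ₗ partialBoundary S = 0 from LinearMap.congr_fun h z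
  refine Finsupp.lhom_ext' fun c => LinearMap.ext_ring ?_
  obtain ⟨ℓ, I⟩ := c
  have key := sum_symm_eq_zero (I \ S) (fun v w =>
    single ((ℓ, (I.erase v).erase w) : Cell ι) (1 : ZMod 2) +
    single ((ℓ + Pi.single w 1, (I.erase v).erase w) : Cell ι) 1 +
    (single ((ℓ + Pi.single v 1, (I.erase v).erase w) : Cell ι) 1 +
    single ((ℓ + Pi.single v 1 + Pi.single w 1, (I.erase v).erase w) : Cell ι) 1))
    (fun v w => by
      rw [Finset.erase_right_comm, add_right_comm ℓ]
      abel)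
  simp only [LinearMap.coe_comp, Function.comp_apply, lsingle_apply, LinearMap.zero_apply]
  rw [partialBoundary_single, map_sum, ← key]
  refine Finset.sum_congr rfl fun v _ => ?_
  rw [map_add, partialBoundary_single, partialBoundary_single, ← Finset.sum_add_distrib,
    Finset.erase_sdiff_comm]

theorem coeffSum_partialBoundary (S : Finset ι) (z : Chain ι) :
    coeffSum (partialBoundary S z) = 0 := by
  suffices h : coeffSum ∘ₗ partialBoundary S = 0 from LinearMap.congr_fun h z
  refine Finsupp.lhom_ext' fun c => LinearMap.ext_ring ?_
  simp only [LinearMap.coe_comp, Function.comp_apply, lsingle_apply, LinearMap.zero_apply]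
  rw [partialBoundary_single, map_sum]
  refine Finset.sum_eq_zero fun v _ => ?_
  rw [map_add, coeffSum_single, coeffSum_single]
  exact CharTwo.add_self_eq_zero _

/-- The coefficient of the boundary at a face is the sum of the coefficients of its cofaces. -/
theorem partialBoundary_apply [Fintype ι] (S : Finset ι) (z : Chain ι) (ℓ : ι → ℤ) (K : Finset ι) :
    partialBoundary S z (ℓ, K) =
      ∑ v ∈ (K ∪ S)ᶜ, (z (ℓ, insert v K) + z (ℓ - Pi.single v 1, insert v K)) := by
  suffices h : Finsupp.lapply (ℓ, K) ∘ₗ partialBoundary S =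
      ∑ v ∈ (K ∪ S)ᶜ, (Finsupp.lapply (ℓ, insert v K) +
        Finsupp.lapply (ℓ - Pi.single v 1, insert v K) : Chain ι →ₗ[ZMod 2] ZMod 2) by
    simpa using LinearMap.congr_fun h z
  refine Finsupp.lhom_ext' fun c => LinearMap.ext_ring ?_
  obtain ⟨m, I⟩ := c
  simp only [LinearMap.coe_comp, Function.comp_apply, lsingle_apply, lapply_apply,
    LinearMap.sum_apply, LinearMap.add_apply]
  rw [partialBoundary_single, Finsupp.finsetSum_apply]
  simp only [Finsupp.add_apply]
  have e₁ : I \ S = Finset.univ.filter fun v => v ∈ I ∧ v ∉ S := by ext; simp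
  have e₂ : (K ∪ S)ᶜ = Finset.univ.filter fun v => v ∉ K ∧ v ∉ S := by ext; simp
  rw [e₁, e₂, Finset.sum_filter, Finset.sum_filter]
  refine Finset.sum_congr rfl fun v _ => ?_
  have hI : (v ∈ I ∧ I.erase v = K) ↔ (v ∉ K ∧ I = insert v K) := by
    constructor
    · rintro ⟨h, rfl⟩
      exact ⟨Finset.notMem_erase _ _, (Finset.insert_erase h).symm⟩
    · rintro ⟨h, rfl⟩
      exact ⟨Finset.mem_insert_self _ _, Finset.erase_insert h⟩
  have hm : m + Pi.single v 1 = ℓ ↔ m = ℓ - Pi.single v 1 := eq_sub_iff_add_eq.symm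
  simp only [single_apply, Prod.mk.injEq, hm]
  by_cases hS : v ∈ S
  · simp [hS]
  · by_cases h : v ∈ I ∧ I.erase v = K
    · have h' := hI.1 h
      simp [hS, h.1, h.2, h'.1, ← h'.2]
    · have h' := fun x => h (hI.2 x)
      push Not at h
      by_cases h1 : v ∈ I <;> by_cases h2 : v ∈ K <;> simp_all

end CubicalLattice

/-! ### Acyclicity of collapsible fibres -/

namespace CubicalLattice

open Finsupp

variable {ι : Type*} [Fintype ι] [DecidableEq ι]

/-- A set of cells that contains, with each cell, its faces in the directions outside `S`. -/
def FaceClosed (S : Finset ι) (C : Set (Cell ι)) : Prop :=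
  ∀ ℓ I w, (ℓ, I) ∈ C → w ∈ I → w ∉ S →
    (ℓ, I.erase w) ∈ C ∧ (ℓ + Pi.single w 1, I.erase w) ∈ C

/-- The chain `z` is a combination of `p`-dimensional cells of `C`. -/
def SupportedOn (C : Set (Cell ι)) (p : ℕ) (z : Chain ι) : Prop :=
  ∀ x, z x ≠ 0 → x ∈ C ∧ x.2.card = p

omit [Fintype ι] [DecidableEq ι] in
theorem SupportedOn.add {C : Set (Cell ι)} {p : ℕ} {y z : Chain ι} (hy : SupportedOn C p y)
    (hz : SupportedOn C p z) : SupportedOn C p (y + z) := by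
  intro x hx
  by_cases h : y x = 0
  · exact hz x fun h' => hx (by simp [h, h'])
  · exact hy x h

omit [Fintype ι] [DecidableEq ι] in
theorem SupportedOn.mono {C C' : Set (Cell ι)} {p : ℕ} {z : Chain ι} (hz : SupportedOn C p z)
    (h : C ⊆ C') : SupportedOn C' p z :=
  fun x hx => ⟨h (hz x hx).1, (hz x hx).2⟩

theorem exists_coface_of_partialBoundary_ne_zero {S : Finset ι} {z : Chain ι} {ℓ : ι → ℤ}
    {K : Finset ι} (h : partialBoundary S z (ℓ, K) ≠ 0) :
    ∃ v, v ∉ K ∧ v ∉ S ∧ (z (ℓ, insert v K) ≠ 0 ∨ z (ℓ - Pi.single v 1, insert v K) ≠ 0) := by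
  rw [partialBoundary_apply] at h
  obtain ⟨v, hv, hne⟩ := Finset.exists_ne_zero_of_sum_ne_zero h
  simp only [Finset.mem_compl, Finset.mem_union, not_or] at hv
  refine ⟨v, hv.1, hv.2, ?_⟩
  by_contra! h'
  exact hne (by simp [h'.1, h'.2])

theorem SupportedOn.partialBoundary {S : Finset ι} {C : Set (Cell ι)} {p : ℕ} {z : Chain ι}
    (hC : FaceClosed S C) (hz : SupportedOn C (p + 1) z) :
    SupportedOn C p (partialBoundary S z) := by
  rintro ⟨ℓ, K⟩ hx
  obtain ⟨v, hK, hS, h⟩ := exists_coface_of_partialBoundary_ne_zero hx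
  have hc := Finset.card_insert_of_notMem hK
  rcases h with h | h
  · obtain ⟨h1, h2⟩ := hz _ h
    have := (hC _ _ v h1 (Finset.mem_insert_self _ _) hS).1
    rw [Finset.erase_insert hK] at this
    exact ⟨this, by simp only at h2 ⊢; omega⟩
  · obtain ⟨h1, h2⟩ := hz _ h
    have := (hC _ _ v h1 (Finset.mem_insert_self _ _) hS).2
    rw [Finset.erase_insert hK, sub_add_cancel] at this
    exact ⟨this, by simp only at h2 ⊢; omega⟩

/-- An elementary collapse in the direction `v`. The cells with `v`-coordinate `c` and without the
direction `v` are the free faces; each of them is matched with its coface in the direction `v`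
that lies above it (`δ = 0`) or below it (`δ = 1`), its other coface not being in `C`. Every cycle
is homologous to one without cells of either kind. -/
theorem exists_collapse {S : Finset ι} {v : ι} (hv : v ∉ S) (c δ : ℤ) (hδ : δ = 0 ∨ δ = 1)
    {C : Set (Cell ι)} (hC : FaceClosed S C)
    (hout : ∀ ℓ I, (ℓ, I) ∈ C → v ∈ I → ℓ v ≠ c - (1 - δ))
    (hmatch : ∀ ℓ K, (ℓ, K) ∈ C → v ∉ K → ℓ v = c → (ℓ - Pi.single v δ, insert v K) ∈ C)
    {p : ℕ} {z : Chain ι} (hz : SupportedOn C p z) (hbz : partialBoundary S z = 0) :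
    ∃ y, SupportedOn C (p + 1) y ∧
      SupportedOn {x | x ∈ C ∧ ¬(v ∉ x.2 ∧ x.1 v = c) ∧ ¬(v ∈ x.2 ∧ x.1 v = c - δ)} p
        (z + partialBoundary S y) := by
  classical
  let y : Chain ι := Finsupp.onFinset
    (z.support.image fun x => (x.1 - Pi.single v δ, insert v x.2))
    (fun x => if v ∈ x.2 ∧ x.1 v = c - δ then z (x.1 + Pi.single v δ, x.2.erase v) else 0) (by
      rintro ⟨ℓ, I⟩ h
      simp only [ne_eq, ite_eq_right_iff, Classical.not_imp] at h
      refine Finset.mem_image.2 ⟨_, Finsupp.mem_support_iff.2 h.2, ?_⟩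
      simp [Finset.insert_erase h.1.1])
  have hy : ∀ ℓ I, y (ℓ, I) =
      if v ∈ I ∧ ℓ v = c - δ then z (ℓ + Pi.single v δ, I.erase v) else 0 := fun _ _ => rfl
  have hyC : SupportedOn C (p + 1) y := by
    rintro ⟨ℓ, I⟩ h
    rw [hy] at h
    simp only [ne_eq, ite_eq_right_iff, Classical.not_imp] at h
    obtain ⟨⟨h1, h2⟩, h3⟩ := h
    obtain ⟨h4, h5⟩ := hz _ h3
    have := hmatch _ _ h4 (Finset.notMem_erase _ _) (by simp [h2])
    rw [Finset.insert_erase h1, add_sub_cancel_right] at this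
    refine ⟨this, ?_⟩
    simp only [Finset.card_erase_of_mem h1] at h5
    have := Finset.card_pos.2 ⟨v, h1⟩
    simp only
    omega
  have hzC : SupportedOn C p (z + partialBoundary S y) := hz.add (hyC.partialBoundary hC)
  -- the free faces do not occur any more
  have free : ∀ ℓ K, v ∉ K → ℓ v = c → (z + partialBoundary S y) (ℓ, K) = 0 := by
    intro ℓ K hK hℓ
    have hyK : partialBoundary S y (ℓ, K) = z (ℓ, K) := by
      rw [partialBoundary_apply, Finset.sum_eq_single v]
      · rw [hy, hy]
        rcases hδ with rfl | rfl
        · simp [hℓ, hK]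
        · have : c ≠ c - 1 := by omega
          simp [hℓ, hK, this]
      · intro w hw hwv
        have : v ∉ insert w K := by simp [hwv.symm, hK]
        simp [hy, this]
      · intro h
        simp [hK, hv] at h
    rw [Finsupp.add_apply, hyK]
    exact CharTwo.add_self_eq_zero _
  refine ⟨y, hyC, ?_⟩
  rintro ⟨ℓ, I⟩ hx
  refine ⟨⟨(hzC _ hx).1, fun h => hx (free _ _ h.1 h.2), ?_⟩, (hzC _ hx).2⟩
  rintro ⟨hI, hℓ⟩
  simp only at hI hℓ
  -- the matched coface is the only cell of the new cycle on its free face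
  have hb : partialBoundary S (z + partialBoundary S y) (ℓ + Pi.single v δ, I.erase v) = 0 := by
    rw [map_add, hbz, partialBoundary_partialBoundary]
    simp
  have hout' : ∀ m, m v = c - (1 - δ) → (z + partialBoundary S y) (m, I) = 0 := by
    intro m hm
    by_contra h
    exact hout m I (hzC _ h).1 hI hm
  rw [partialBoundary_apply, Finset.sum_eq_single v] at hb
  · rw [Finset.insert_erase hI] at hb
    rcases hδ with rfl | rfl
    · rw [hout' (ℓ + Pi.single v 0 - Pi.single v 1) (by simp [hℓ]), add_zero, Pi.single_zero,
        add_zero] at hb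
      exact hx hb
    · rw [hout' (ℓ + Pi.single v 1) (by simp [hℓ]), zero_add, add_sub_cancel_right] at hb
      exact hx hb
  · intro w hw hwv
    have : v ∉ insert w (I.erase v) := by simp [hwv.symm]
    rw [free _ _ this (by simp [hℓ]), free _ _ this (by simp [hℓ, Pi.single_eq_of_ne hwv.symm]),
      add_zero]
  · intro h
    simp [hv] at h

/-- The lattice point `ℓ + ∑_{v ∈ J} v`. -/
def corner (ℓ : ι → ℤ) (J : Finset ι) : ι → ℤ := ℓ + ∑ v ∈ J, Pi.single v 1

omit [Fintype ι] in
theorem corner_apply (ℓ : ι → ℤ) (J : Finset ι) (v : ι) :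
    corner ℓ J v = ℓ v + if v ∈ J then 1 else 0 := by
  simp [corner, Finset.sum_apply, Pi.single_apply]

/-- The maximum of `f` over the vertices of a cell. -/
def cellMax (f : (ι → ℤ) → ℤ) (c : Cell ι) : ℤ :=
  c.2.powerset.sup' ⟨∅, Finset.empty_mem_powerset _⟩ fun J => f (corner c.1 J)

omit [Fintype ι] in
theorem le_cellMax (f : (ι → ℤ) → ℤ) (ℓ : ι → ℤ) {I J : Finset ι} (h : J ⊆ I) :
    f (corner ℓ J) ≤ cellMax f (ℓ, I) :=
  Finset.le_sup' (fun J => f (corner ℓ J)) (Finset.mem_powerset.2 h)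

omit [Fintype ι] in
theorem cellMax_le {f : (ι → ℤ) → ℤ} {ℓ : ι → ℤ} {I : Finset ι} {a : ℤ}
    (h : ∀ J ⊆ I, f (corner ℓ J) ≤ a) : cellMax f (ℓ, I) ≤ a :=
  Finset.sup'_le _ _ fun J hJ => h J (Finset.mem_powerset.1 hJ)

omit [Fintype ι] in
theorem exists_eq_cellMax (f : (ι → ℤ) → ℤ) (ℓ : ι → ℤ) (I : Finset ι) :
    ∃ J ⊆ I, cellMax f (ℓ, I) = f (corner ℓ J) := by
  obtain ⟨J, hJ, h⟩ := Finset.exists_mem_eq_sup' (s := I.powerset)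
    ⟨∅, Finset.empty_mem_powerset _⟩ fun J => f (corner ℓ J)
  exact ⟨J, Finset.mem_powerset.1 hJ, h⟩

/-- The box `[a, b]` can be shrunk to a lattice point, one lattice step at a time, so that in each
step none of the functions `F j` increases when the face to be removed is moved into the remaining
box. -/
inductive BoxCollapse {κ : Type*} (F : κ → (ι → ℤ) → ℤ) : (ι → ℤ) → (ι → ℤ) → Prop
  | point (a : ι → ℤ) : BoxCollapse F a a
  | lower {a b : ι → ℤ} (v : ι) (hv : a v < b v)
      (h : ∀ x, a ≤ x → x ≤ b → x v = a v → ∀ j, F j (x + Pi.single v 1) ≤ F j x)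
      (hab : BoxCollapse F (a + Pi.single v 1) b) : BoxCollapse F a b
  | upper {a b : ι → ℤ} (v : ι) (hv : a v < b v)
      (h : ∀ x, a ≤ x → x ≤ b → x v = b v → ∀ j, F j (x - Pi.single v 1) ≤ F j x)
      (hab : BoxCollapse F a (b - Pi.single v 1)) : BoxCollapse F a b

/-- The cells with exactly the directions `D` among those of `B`, whose projection along the
directions of `B` lies in the box `[a, b]`. -/
def boxCells (B D : Finset ι) (a b : ι → ℤ) : Set (Cell ι) :=
  {x | x.2 ∩ B = D ∧ a ≤ x.1 ∧ corner x.1 (x.2 \ B) ≤ b}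

omit [Fintype ι] in
theorem faceClosed_boxCells (B D : Finset ι) (a b : ι → ℤ) : FaceClosed B (boxCells B D a b) := by
  rintro ℓ I w ⟨hD, ha, hb⟩ hI hw
  have hD' : I.erase w ∩ B = D := by
    rw [← hD]
    ext u
    simp only [Finset.mem_inter, Finset.mem_erase]
    constructor
    · tauto
    · rintro ⟨h1, h2⟩
      exact ⟨⟨fun e => hw (e ▸ h2), h1⟩, h2⟩
  refine ⟨⟨hD', ha, fun u => ?_⟩, hD', fun u => ?_, fun u => ?_⟩
  · have := hb u
    simp only [corner_apply, Finset.mem_sdiff, Finset.mem_erase] at this ⊢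
    by_cases h : u = w
    · subst h; simp_all; omega
    · simp_all
  · have := ha u
    by_cases h : u = w
    · subst h; simp; simp at this; omega
    · simpa [h] using this
  · have := hb u
    simp only [corner_apply, Finset.mem_sdiff, Finset.mem_erase] at this ⊢
    by_cases h : u = w
    · subst h; simp_all
    · simp_all

section Collapse

variable {κ : Type*} {f : κ → (ι → ℤ) → ℤ} {B D : Finset ι} {C : Set (Cell ι)}

omit [Fintype ι] in
theorem corner_corner (ℓ : ι → ℤ) {J K : Finset ι} (h : Disjoint J K) :
    corner (corner ℓ J) K = corner ℓ (J ∪ K) := by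
  simp [corner, Finset.sum_union h, add_assoc]

omit [Fintype ι] in
/-- The maximum over the cell `(ℓ', K ∪ {v})` is bounded by the one over `(ℓ, K)` as soon as this
holds for the maxima over the translates of the face with directions `D`. -/
theorem cellMax_insert_le {g : (ι → ℤ) → ℤ} {ℓ : ι → ℤ} {K : Finset ι} (v : ι)
    (hvB : v ∉ B) (hD : K ∩ B = D)
    (ℓ' : ι → ℤ)
    (h : ∀ J ⊆ K \ B, cellMax g (corner ℓ' J, D) ≤ cellMax g (corner ℓ J, D))
    (h' : ∀ J ⊆ K \ B, cellMax g (corner ℓ' J + Pi.single v 1, D) ≤ cellMax g (corner ℓ J, D)) :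
    cellMax g (ℓ', insert v K) ≤ cellMax g (ℓ, K) := by
  refine cellMax_le fun J hJ => ?_
  have hsplit : ∀ J ⊆ K, ∀ x, cellMax g (corner x (J \ B), D) ≤ cellMax g (x, K) := by
    intro J hJ x
    refine cellMax_le fun J' hJ' => ?_
    rw [corner_corner]
    · refine le_cellMax g x (Finset.union_subset (Finset.sdiff_subset.trans hJ) ?_)
      exact hJ'.trans (hD ▸ Finset.inter_subset_left)
    · refine Finset.disjoint_left.2 fun u hu hu' => ?_
      have := hJ' hu'
      rw [← hD] at this
      exact (Finset.mem_sdiff.1 hu).2 (Finset.mem_inter.1 this).2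
  have hJK : J.erase v ⊆ K := by
    intro u hu
    have := hJ (Finset.mem_of_mem_erase hu)
    simpa [Finset.ne_of_mem_erase hu] using this
  have hdis : Disjoint (J.erase v \ B) (J ∩ B) := by
    refine Finset.disjoint_left.2 fun u hu hu' => ?_
    exact (Finset.mem_sdiff.1 hu).2 (Finset.mem_inter.1 hu').2
  have hJD : J ∩ B ⊆ D := by
    intro u hu
    rw [← hD]
    have h1 := Finset.mem_inter.1 hu
    have h2 : u ≠ v := fun e => hvB (e ▸ h1.2)
    exact Finset.mem_inter.2 ⟨hJK (Finset.mem_erase.2 ⟨h2, h1.1⟩), h1.2⟩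
  have hsub : J.erase v \ B ⊆ K \ B := Finset.sdiff_subset_sdiff hJK le_rfl
  have key : ∀ x : ι → ℤ, corner (corner x (J.erase v \ B)) (J ∩ B) = corner x (J.erase v) := by
    intro x
    rw [corner_corner x hdis]
    congr 1
    ext u
    simp only [Finset.mem_union, Finset.mem_sdiff, Finset.mem_erase, Finset.mem_inter]
    constructor
    · rintro (h | h)
      · exact h.1
      · exact ⟨fun e => hvB (e ▸ h.2), h.1⟩
    · tauto
  by_cases hv : v ∈ J
  · have : corner ℓ' J = corner (corner ℓ' (J.erase v \ B) + Pi.single v 1) (J ∩ B) := by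
      have := key ℓ'
      ext u
      have := congrFun this u
      simp only [corner_apply, Pi.add_apply, Finset.mem_erase] at this ⊢
      by_cases huv : u = v
      · subst huv; simp [hvB, hv]
      · simp [huv] at this ⊢; omega
    rw [this]
    exact (le_cellMax g _ hJD).trans ((h' _ hsub).trans (hsplit _ hJK ℓ))
  · have : corner ℓ' J = corner (corner ℓ' (J.erase v \ B)) (J ∩ B) := by
      rw [key, Finset.erase_eq_of_notMem hv]
    rw [this]
    exact (le_cellMax g _ hJD).trans ((h _ hsub).trans (hsplit _ hJK ℓ))

omit [Fintype ι] in
theorem faceClosed_of_cellMax (S : Finset ι)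
    (hC : ∀ c c', (∀ j, cellMax (f j) c' ≤ cellMax (f j) c) → c ∈ C → c' ∈ C) :
    FaceClosed S C := by
  intro ℓ I w h hI _
  refine ⟨hC _ _ (fun j => cellMax_le fun J hJ => ?_) h,
    hC _ _ (fun j => cellMax_le fun J hJ => ?_) h⟩
  · exact le_cellMax _ _ (hJ.trans (Finset.erase_subset _ _))
  · have hw : w ∉ J := fun hw => Finset.notMem_erase w I (hJ hw)
    have : corner (ℓ + Pi.single w 1) J = corner ℓ (insert w J) := by
      simp [corner, Finset.sum_insert hw, add_assoc]
    rw [this]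
    exact le_cellMax _ _ (Finset.insert_subset hI (hJ.trans (Finset.erase_subset _ _)))

/-- If a box collapses to a point, then the complex that is formed by the cells of `C` in the box
with exactly the directions `D` in `B` has no reduced homology. -/
theorem exists_bounding_chain_of_boxCollapse
    (hC : ∀ c c', (∀ j, cellMax (f j) c' ≤ cellMax (f j) c) → c ∈ C → c' ∈ C) {a b : ι → ℤ}
    (hab : BoxCollapse (fun j x => cellMax (f j) (x, D)) a b) (heq : ∀ v ∈ B, a v = b v)
    {p : ℕ} {z : Chain ι} (hz : SupportedOn (C ∩ boxCells B D a b) p z)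
    (hbz : partialBoundary B z = 0) (hsum : p = D.card → coeffSum z = 0) :
    ∃ y, SupportedOn (C ∩ boxCells B D a b) (p + 1) y ∧ partialBoundary B y = z := by
  have hCface := faceClosed_of_cellMax (f := f) B hC
  have hface : ∀ a b, FaceClosed B (C ∩ boxCells B D a b) := fun a b ℓ I w h hI hw =>
    ⟨⟨(hCface ℓ I w h.1 hI hw).1, (faceClosed_boxCells B D a b ℓ I w h.2 hI hw).1⟩,
      (hCface ℓ I w h.1 hI hw).2, (faceClosed_boxCells B D a b ℓ I w h.2 hI hw).2⟩
  -- the inductive step, common to the two kinds of moves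
  have step : ∀ {a b a' b' : ι → ℤ} {z : Chain ι} (v : ι) (c δ : ℤ), v ∉ B → (δ = 0 ∨ δ = 1) →
      SupportedOn (C ∩ boxCells B D a b) p z → partialBoundary B z = 0 →
      (p = D.card → coeffSum z = 0) →
      (∀ ℓ I, (ℓ, I) ∈ boxCells B D a b → v ∈ I → ℓ v ≠ c - (1 - δ)) →
      (∀ ℓ K, (ℓ, K) ∈ C ∩ boxCells B D a b → v ∉ K → ℓ v = c →
        (ℓ - Pi.single v δ, insert v K) ∈ C ∩ boxCells B D a b) →
      (∀ x ∈ boxCells B D a b, ¬(v ∉ x.2 ∧ x.1 v = c) → ¬(v ∈ x.2 ∧ x.1 v = c - δ) →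
        x ∈ boxCells B D a' b') →
      boxCells B D a' b' ⊆ boxCells B D a b →
      (∀ z : Chain ι, SupportedOn (C ∩ boxCells B D a' b') p z → partialBoundary B z = 0 →
        (p = D.card → coeffSum z = 0) →
        ∃ y, SupportedOn (C ∩ boxCells B D a' b') (p + 1) y ∧ partialBoundary B y = z) →
      ∃ y, SupportedOn (C ∩ boxCells B D a b) (p + 1) y ∧ partialBoundary B y = z := by
    intro a b a' b' z v c δ hv hδ hz hbz hsum hout hmatch hrest hsub ih
    obtain ⟨y, hy, hzy⟩ := exists_collapse hv c δ hδ (hface a b)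
      (fun ℓ I h => hout ℓ I h.2) hmatch hz hbz
    obtain ⟨y', hy', h⟩ := ih (z + partialBoundary B y)
      (hzy.mono fun x hx => ⟨hx.1.1, hrest x hx.1.2 hx.2.1 hx.2.2⟩)
      (by rw [map_add, hbz, partialBoundary_partialBoundary, add_zero])
      (fun h => by rw [map_add, hsum h, coeffSum_partialBoundary, add_zero])
    refine ⟨y + y', hy.add (hy'.mono fun x hx => ⟨hx.1, hsub hx.2⟩), ?_⟩
    rw [map_add, h, add_comm z, ← add_assoc, ZModModule.add_self, zero_add]
  induction hab generalizing z with
  | point a =>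
    have hcell : ∀ x, z x ≠ 0 → x = (a, D) := by
      rintro ⟨ℓ, I⟩ hx
      obtain ⟨h1, h2, h3⟩ := (hz _ hx).1.2
      simp only at h1 h2 h3
      have hI : I \ B = ∅ := by
        refine Finset.eq_empty_of_forall_notMem fun u hu => ?_
        have := h3 u
        have := h2 u
        simp only [corner_apply, hu, if_true] at *
        omega
      rw [hI] at h3
      have : ℓ = a := le_antisymm (by simpa [corner] using h3) h2
      rw [this, ← h1, Finset.inter_eq_left.2 (Finset.sdiff_eq_empty_iff_subset.1 hI)]
    have hzs : z = single (a, D) (z (a, D)) := by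
      ext x
      by_cases h : x = (a, D)
      · subst h; simp
      · rw [single_eq_of_ne h]
        by_contra h'
        exact h (hcell x h')
    refine ⟨0, fun x hx => absurd rfl hx, ?_⟩
    rw [map_zero]
    by_contra hne
    have h0 : z (a, D) ≠ 0 := fun h => hne (by rw [hzs, h, single_zero])
    apply h0
    have := hsum (hz _ h0).2.symm
    rw [hzs] at this
    simpa [coeffSum] using this
  | @lower a b v hv h _ ih =>
    have hvB : v ∉ B := fun h => by have := heq v h; omega
    refine step (a' := a + Pi.single v 1) (b' := b) v (a v) 0 hvB (Or.inl rfl) hz hbz hsum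
      ?_ ?_ ?_ ?_ ?_
    · intro ℓ I h _
      have := h.2.1 v
      simp only at this
      omega
    · rintro ℓ K ⟨hK, hbox⟩ hvK hℓ
      rw [Pi.single_zero, sub_zero]
      obtain ⟨h1, h2, h3⟩ := hbox
      simp only at h1 h2 h3
      refine ⟨hC _ _ (fun j => cellMax_insert_le v hvB h1 ℓ (fun _ _ => le_rfl)
        fun J hJ => ?_) hK, ?_, h2, fun u => ?_⟩
      · refine h _ (fun u => ?_) (fun u => ?_) ?_ j
        · have h4 : a u ≤ ℓ u := h2 u
          change a u ≤ corner ℓ J u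
          rw [corner_apply]
          split_ifs <;> omega
        · have h4 : corner ℓ (K \ B) u ≤ b u := h3 u
          change corner ℓ J u ≤ b u
          rw [corner_apply] at h4 ⊢
          by_cases hu : u ∈ J
          · rw [if_pos (hJ hu)] at h4
            rwa [if_pos hu]
          · rw [if_neg hu]
            split_ifs at h4 <;> omega
        · have : v ∉ J := fun h => hvK (Finset.mem_sdiff.1 (hJ h)).1
          simp [corner_apply, this, hℓ]
      · rw [← h1]
        exact Finset.insert_inter_of_notMem hvB
      · have := h3 u
        by_cases huv : u = v
        · subst huv
          simp [corner_apply, hvB]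
          omega
        · simpa [corner_apply, huv] using this
    · rintro ⟨ℓ, I⟩ ⟨h1, h2, h3⟩ h4 h5
      refine ⟨h1, fun u => ?_, h3⟩
      have := h2 u
      by_cases huv : u = v
      · subst huv
        simp at h4 h5 this ⊢
        by_cases hI : u ∈ I
        · have := h5 hI; omega
        · have := h4 hI; omega
      · simpa [huv] using this
    · rintro ⟨ℓ, I⟩ ⟨h1, h2, h3⟩
      refine ⟨h1, le_trans (fun u => ?_) h2, h3⟩
      by_cases huv : u = v
      · subst huv; simp
      · simp [huv]
    · intro z hz hbz hsum
      refine ih (fun u hu => ?_) hz hbz hsum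
      have : u ≠ v := fun e => hvB (e ▸ hu)
      simp [this, heq u hu]
  | @upper a b v hv h _ ih =>
    have hvB : v ∉ B := fun h => by have := heq v h; omega
    refine step (a' := a) (b' := b - Pi.single v 1) v (b v) 1 hvB (Or.inr rfl) hz hbz hsum
      ?_ ?_ ?_ ?_ ?_
    · intro ℓ I h hI
      have := h.2.2 v
      simp [corner_apply, hI, hvB] at this
      omega
    · rintro ℓ K ⟨hK, hbox⟩ hvK hℓ
      obtain ⟨h1, h2, h3⟩ := hbox
      simp only at h1 h2 h3
      have hcor : ∀ J, corner (ℓ - Pi.single v 1) J + Pi.single v 1 = corner ℓ J := by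
        intro J; simp [corner]; abel
      refine ⟨hC _ _ (fun j => cellMax_insert_le v hvB h1 _ (fun J hJ => ?_)
        fun J hJ => by rw [hcor]) hK, ?_, fun u => ?_, fun u => ?_⟩
      · rw [eq_sub_of_add_eq (hcor J)]
        refine h _ (fun u => ?_) (fun u => ?_) ?_ j
        · have h4 : a u ≤ ℓ u := h2 u
          change a u ≤ corner ℓ J u
          rw [corner_apply]
          split_ifs <;> omega
        · have h4 : corner ℓ (K \ B) u ≤ b u := h3 u
          change corner ℓ J u ≤ b u
          rw [corner_apply] at h4 ⊢
          by_cases hu : u ∈ J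
          · rw [if_pos (hJ hu)] at h4
            rwa [if_pos hu]
          · rw [if_neg hu]
            split_ifs at h4 <;> omega
        · have : v ∉ J := fun h => hvK (Finset.mem_sdiff.1 (hJ h)).1
          simp [corner_apply, this, hℓ]
      · rw [← h1]
        exact Finset.insert_inter_of_notMem hvB
      · have := h2 u
        by_cases huv : u = v
        · subst huv
          simp
          omega
        · simpa [huv] using this
      · have := h3 u
        by_cases huv : u = v
        · subst huv
          simp [corner_apply, hvB]
          omega
        · simpa [corner_apply, huv] using this
    · rintro ⟨ℓ, I⟩ ⟨h1, h2, h3⟩ h4 h5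
      refine ⟨h1, h2, fun u => ?_⟩
      have := h3 u
      by_cases huv : u = v
      · subst huv
        simp [corner_apply, hvB] at h4 h5 this ⊢
        by_cases hI : u ∈ I
        · have := h5 hI; simp [hI] at *; omega
        · have := h4 hI; simp [hI] at *; omega
      · simpa [huv] using this
    · rintro ⟨ℓ, I⟩ ⟨h1, h2, h3⟩
      refine ⟨h1, h2, le_trans h3 fun u => ?_⟩
      by_cases huv : u = v
      · subst huv; simp
      · simp [huv]
    · intro z hz hbz hsum
      refine ih (fun u hu => ?_) hz hbz hsum
      have : u ≠ v := fun e => hvB (e ▸ hu)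
      simp [this, heq u hu]

end Collapse

end CubicalLattice

/-! ### Energies on rooted forests -/

open CubicalLattice

/-- A rooted forest on `ι`, given by its parent function. The vertices without a parent in `ι` are
those attached to an additional root, which is not an element of `ι`. -/
structure RootedForest (ι : Type*) where
  par : ι → Option ι
  depth : ι → ℕ
  depth_lt : ∀ v p, par v = some p → depth p < depth v

namespace RootedForest

variable {ι : Type*} [Fintype ι] [DecidableEq ι] (T : RootedForest ι)

/-- The value of `x` at the parent of `v`, where the additional root has the value `ε`. -/
def parVal (ε : ℤ) (x : ι → ℤ) (v : ι) : ℤ := (T.par v).elim ε x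

/-- The sum of the values of `x` over the children of `v`. -/
def childSum (x : ι → ℤ) (v : ι) : ℤ := ∑ w, if T.par w = some v then x w else 0

/-- The sum of the potentials `φ v (x v)` minus the sum of the products of the values of `x` at
the two ends of each edge, where the additional root has the value `ε`. -/
def energy (φ : ι → ℤ → ℤ) (ε : ℤ) (x : ι → ℤ) : ℤ := ∑ v, (φ v (x v) - x v * T.parVal ε x v)

/-- The increment of the energy when `x` is raised by one at `v`, for potentials with increments
`κ v - e v * n`. -/
def slope (κ e : ι → ℤ) (ε : ℤ) (x : ι → ℤ) (v : ι) : ℤ :=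
  κ v - e v * x v - T.parVal ε x v - T.childSum x v

omit [Fintype ι] [DecidableEq ι] in
theorem par_ne_self (v : ι) : T.par v ≠ some v := fun h => lt_irrefl _ (T.depth_lt v v h)

omit [Fintype ι] [DecidableEq ι] in
theorem parVal_add (ε ε' : ℤ) (x y : ι → ℤ) (v : ι) :
    T.parVal (ε + ε') (x + y) v = T.parVal ε x v + T.parVal ε' y v := by
  unfold parVal
  cases T.par v <;> simp

theorem childSum_add (x y : ι → ℤ) (v : ι) :
    T.childSum (x + y) v = T.childSum x v + T.childSum y v := by
  unfold childSum
  rw [← Finset.sum_add_distrib]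
  exact Finset.sum_congr rfl fun w _ => by split_ifs <;> simp

omit [Fintype ι] [DecidableEq ι] in
theorem parVal_mono {ε ε' : ℤ} {x y : ι → ℤ} (hε : ε ≤ ε') (h : x ≤ y) (v : ι) :
    T.parVal ε x v ≤ T.parVal ε' y v := by
  unfold parVal
  cases T.par v with
  | none => simpa
  | some p => exact h p

theorem childSum_mono {x y : ι → ℤ} (v : ι) (h : ∀ w, T.par w = some v → x w ≤ y w) :
    T.childSum x v ≤ T.childSum y v :=
  Finset.sum_le_sum fun w _ => by
    split_ifs with hw
    · exact h w hw
    · exact le_rfl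

theorem slope_anti (κ e : ι → ℤ) {ε ε' : ℤ} {x y : ι → ℤ} {v : ι} (hε : ε ≤ ε') (h : x ≤ y)
    (hv : x v = y v) : T.slope κ e ε' y v ≤ T.slope κ e ε x v := by
  have h1 := T.parVal_mono hε h v
  have h2 := T.childSum_mono v fun w _ => h w
  unfold slope
  rw [hv]
  omega

theorem slope_add (κ e : ι → ℤ) (ε ε' : ℤ) (x y : ι → ℤ) (v : ι) :
    T.slope κ e (ε + ε') (x + y) v =
      T.slope κ e ε x v - e v * y v - T.parVal ε' y v - T.childSum y v := by
  unfold slope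
  rw [parVal_add, childSum_add, Pi.add_apply]
  ring

theorem energy_add_single {φ : ι → ℤ → ℤ} {κ e : ι → ℤ}
    (hφ : ∀ v n, φ v (n + 1) - φ v n = κ v - e v * n) (ε : ℤ) (x : ι → ℤ) (v : ι) :
    T.energy φ ε (x + Pi.single v 1) = T.energy φ ε x + T.slope κ e ε x v := by
  have key : ∀ u, (φ u ((x + Pi.single v 1 : ι → ℤ) u) -
      (x + Pi.single v 1 : ι → ℤ) u * T.parVal ε (x + Pi.single v 1) u) =
      (φ u (x u) - x u * T.parVal ε x u) +
      (if u = v then κ v - e v * x v - T.parVal ε x v else 0) -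
      (if T.par u = some v then x u else 0) := by
    intro u
    have hp : T.parVal ε (x + Pi.single v 1) u =
        T.parVal ε x u + if T.par u = some v then 1 else 0 := by
      unfold parVal
      cases h : T.par u with
      | none => simp
      | some p =>
        simp only [Option.elim_some, Pi.add_apply, Option.some.injEq]
        rw [Pi.single_apply]
    rw [hp]
    by_cases huv : u = v
    · subst huv
      have := hφ u (x u)
      simp [T.par_ne_self]
      linarith
    · simp [huv]
      split_ifs <;> ring
  unfold energy slope childSum
  simp only [key, Finset.sum_add_distrib, Finset.sum_sub_distrib, Finset.sum_ite_eq',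
    Finset.mem_univ, if_true]
  ring

/-- Exchanging the values of `X` and `Y` on a set of vertices that is joined to its complement by
the edge above `v` only changes the sum of the energies by the contribution of this edge. -/
theorem energy_add_energy_piecewise (φ : ι → ℤ → ℤ) (ε ε' : ℤ) (X Y : ι → ℤ) (S : Finset ι)
    {v : ι} (hv : v ∈ S) (hS : ∀ u ∈ S, u ≠ v → ∃ p ∈ S, T.par u = some p)
    (hS' : ∀ u p, T.par u = some p → p ∈ S → u ∈ S ∧ u ≠ v) :
    T.energy φ ε X + T.energy φ ε' Y =
      T.energy φ ε (S.piecewise Y X) + T.energy φ ε' (S.piecewise X Y) -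
        (Y v - X v) * (T.parVal ε' Y v - T.parVal ε X v) := by
  have hsum : (Y v - X v) * (T.parVal ε' Y v - T.parVal ε X v) = ∑ u, if u = v then
      (Y v - X v) * (T.parVal ε' Y v - T.parVal ε X v) else 0 := by simp
  rw [hsum]
  unfold energy
  rw [← Finset.sum_add_distrib, ← Finset.sum_add_distrib, ← Finset.sum_sub_distrib]
  refine Finset.sum_congr rfl fun u _ => ?_
  by_cases hu : u ∈ S
  · by_cases huv : u = v
    · subst huv
      have : ∀ ε (Z W : ι → ℤ), T.parVal ε (S.piecewise Z W) u = T.parVal ε W u := by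
        intro ε Z W
        unfold parVal
        cases h : T.par u with
        | none => rfl
        | some p =>
          have hp : p ∉ S := fun hp => (hS' u p h hp).2 rfl
          simp [hp]
      simp only [this, Finset.piecewise_eq_of_mem _ _ _ hu, if_true]
      ring
    · obtain ⟨p, hp, h⟩ := hS u hu huv
      simp only [parVal, h, Option.elim_some, Finset.piecewise_eq_of_mem _ _ _ hu,
        Finset.piecewise_eq_of_mem _ _ _ hp, huv, if_false]
      ring
  · have huv : u ≠ v := fun e => hu (e ▸ hv)
    have : ∀ ε (Z W : ι → ℤ), T.parVal ε (S.piecewise Z W) u = T.parVal ε W u := by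
      intro ε Z W
      unfold parVal
      cases h : T.par u with
      | none => rfl
      | some p =>
        have hp : p ∉ S := fun hp => hu (hS' u p h hp).1
        simp [hp]
    simp only [this, Finset.piecewise_eq_of_notMem _ _ _ hu, huv, if_false]
    ring

omit [DecidableEq ι] in
/-- The descendants of `v` are joined to the other vertices by the edge above `v` only. -/
theorem exists_descendants (v : ι) : ∃ S : Finset ι, v ∈ S ∧
    (∀ u ∈ S, u ≠ v → ∃ p ∈ S, T.par u = some p) ∧
    (∀ u p, T.par u = some p → p ∈ S → u ∈ S ∧ u ≠ v) ∧
    (∀ u ∈ S, u ≠ v → T.depth v < T.depth u) := by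
  classical
  let r : ι → ι → Prop := fun u p => T.par u = some p
  have hdepth : ∀ u, Relation.ReflTransGen r u v → T.depth v ≤ T.depth u := by
    intro u h
    induction h using Relation.ReflTransGen.head_induction_on with
    | refl => exact le_rfl
    | head h _ ih => exact ih.trans (T.depth_lt _ _ h).le
  refine ⟨Finset.univ.filter fun u => Relation.ReflTransGen r u v, by simp; rfl, ?_, ?_, ?_⟩
  · intro u hu huv
    rw [Finset.mem_filter] at hu
    rcases Relation.ReflTransGen.cases_head hu.2 with h | ⟨p, h, h'⟩
    · exact absurd h huv
    · exact ⟨p, by simpa using h', h⟩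
  · intro u p h hp
    simp only [Finset.mem_filter, Finset.mem_univ, true_and] at hp ⊢
    refine ⟨Relation.ReflTransGen.head h hp, ?_⟩
    rintro rfl
    exact absurd (hdepth p hp) (not_le.2 (T.depth_lt _ _ h))
  · intro u hu huv
    rw [Finset.mem_filter] at hu
    rcases Relation.ReflTransGen.cases_head hu.2 with h | ⟨p, h, h'⟩
    · exact absurd h huv
    · exact (hdepth p h').trans_lt (T.depth_lt _ _ h)

/-! ### Collapsing boxes -/

section Collapse

variable {κ' : Type*} {φ : ι → ℤ → ℤ} {κ e : ι → ℤ} {ε : κ' → ℤ} {B D : Finset ι}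

omit [Fintype ι] in
theorem corner_add (x y : ι → ℤ) (J : Finset ι) : corner (x + y) J = corner x J + y := by
  simp [corner, add_right_comm]

omit [Fintype ι] in
theorem le_corner (x : ι → ℤ) (J : Finset ι) : x ≤ corner x J := fun v => by
  change x v ≤ corner x J v
  rw [corner_apply]
  split_ifs <;> simp

omit [Fintype ι] in
theorem corner_mono {x y : ι → ℤ} {J K : Finset ι} (h : x ≤ y) (hJ : J ⊆ K) :
    corner x J ≤ corner y K := fun v => by
  have hxy : x v ≤ y v := h v
  change corner x J v ≤ corner y K v
  rw [corner_apply, corner_apply]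
  by_cases hv : v ∈ J
  · simp [hv, hJ hv, hxy]
  · rw [if_neg hv]
    split_ifs <;> omega

theorem cellMax_energy_add_single_le (hφ : ∀ v n, φ v (n + 1) - φ v n = κ v - e v * n) {δ : ℤ}
    (hδ : 0 ≤ δ) {a x : ι → ℤ} {v : ι} (hvD : v ∉ D) (hax : a ≤ x) (hv : x v = a v)
    (h : T.slope κ e 0 a v ≤ 0) :
    cellMax (T.energy φ δ) (x + Pi.single v 1, D) ≤ cellMax (T.energy φ δ) (x, D) := by
  refine cellMax_le fun J hJ => ?_
  refine le_trans ?_ (le_cellMax _ _ hJ)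
  rw [corner_add, T.energy_add_single hφ]
  have : T.slope κ e δ (corner x J) v ≤ T.slope κ e 0 a v := by
    refine T.slope_anti κ e hδ (hax.trans (le_corner x J)) ?_
    have : v ∉ J := fun h => hvD (hJ h)
    simp [corner_apply, this, hv]
  omega

theorem cellMax_energy_sub_single_le (hφ : ∀ v n, φ v (n + 1) - φ v n = κ v - e v * n) {δ : ℤ}
    (hδ : δ ≤ 1) {b x : ι → ℤ} {v : ι} (hvD : v ∉ D) (hxb : x ≤ b) (hv : x v = b v)
    (h : 0 ≤ T.slope κ e 1 (corner b D - Pi.single v 1) v) :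
    cellMax (T.energy φ δ) (x - Pi.single v 1, D) ≤ cellMax (T.energy φ δ) (x, D) := by
  refine cellMax_le fun J hJ => ?_
  refine le_trans ?_ (le_cellMax _ _ hJ)
  have hx : corner x J = corner (x - Pi.single v 1) J + Pi.single v 1 := by
    rw [← corner_add, sub_add_cancel]
  rw [hx, T.energy_add_single hφ, eq_sub_of_add_eq hx.symm]
  have : T.slope κ e 1 (corner b D - Pi.single v 1) v ≤
      T.slope κ e δ (corner x J - Pi.single v 1) v := by
    refine T.slope_anti κ e hδ (sub_le_sub_right (corner_mono hxb hJ) _) ?_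
    have : v ∉ J := fun h => hvD (hJ h)
    simp [corner_apply, this, hvD, hv]
  omega

/-- The lower end of a box can be raised to a point at which the slopes in all directions outside
`B` are positive: a direction in which the slope is not positive allows a step, and the bound `u`
is never exceeded, since slopes decrease when other coordinates are raised. -/
theorem boxCollapse_of_lower (hφ : ∀ v n, φ v (n + 1) - φ v n = κ v - e v * n)
    (hε : ∀ j, 0 ≤ ε j) (hDB : D ⊆ B) {u b : ι → ℤ} (hu : ∀ v ∉ B, 1 ≤ T.slope κ e 0 u v)
    (hub : u ≤ b)
    (H : ∀ m, m ≤ u → (∀ v ∈ B, m v = u v) → (∀ v ∉ B, 1 ≤ T.slope κ e 0 m v) →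
      BoxCollapse (fun j x => cellMax (T.energy φ (ε j)) (x, D)) m b)
    {a : ι → ℤ} (hau : a ≤ u) (haB : ∀ v ∈ B, a v = u v) :
    BoxCollapse (fun j x => cellMax (T.energy φ (ε j)) (x, D)) a b := by
  induction hn : (∑ v, (u v - a v)).toNat using Nat.strong_induction_on generalizing a with
  | _ n ih =>
    by_cases hex : ∃ v, v ∉ B ∧ T.slope κ e 0 a v ≤ 0
    · obtain ⟨v, hvB, hv⟩ := hex
      have hlt : a v < u v := by
        refine lt_of_le_of_ne (hau v) fun h => ?_
        have h1 := T.slope_anti κ e (le_refl (0 : ℤ)) hau h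
        have h2 := hu v hvB
        omega
      refine BoxCollapse.lower v (hlt.trans_le (hub v))
        (fun x hax _ hx j => T.cellMax_energy_add_single_le hφ (hε j) (fun h => hvB (hDB h))
          hax hx hv) (ih _ ?_ ?_ ?_ rfl)
      · have h1 : ∑ w, (u w - (a + Pi.single v 1 : ι → ℤ) w) = ∑ w, (u w - a w) - 1 := by
          simp only [Pi.add_apply, Finset.sum_sub_distrib, Finset.sum_add_distrib,
            Finset.sum_pi_single', Finset.mem_univ, if_true]
          ring
        have h2 : u v - a v ≤ ∑ w, (u w - a w) :=
          Finset.single_le_sum (fun w _ => sub_nonneg.2 (hau w)) (Finset.mem_univ v)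
        rw [h1]
        omega
      · intro w
        by_cases hwv : w = v
        · subst hwv; simp; omega
        · simpa [hwv] using hau w
      · intro w hw
        have hwv : w ≠ v := fun h => hvB (h ▸ hw)
        simpa [hwv] using haB w hw
    · push Not at hex
      exact H a hau haB fun v hv => hex v hv

/-- If the slopes at `m` in all directions outside `B` are positive, then a box with lowest point
`m` can be shrunk to a unit cube. A step is possible in the direction in which the box is longest
and which, among these, has the largest depth. -/
theorem boxCollapse_of_upper (hφ : ∀ v n, φ v (n + 1) - φ v n = κ v - e v * n)
    (hε : ∀ j, ε j ≤ 1) (hDB : D ⊆ B) {m : ι → ℤ} (hm : ∀ v ∉ B, 1 ≤ T.slope κ e 0 m v)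
    (hgood : ∀ v ∉ B, T.parVal 0 1 v + T.childSum 1 v ≤ -e v)
    (H : BoxCollapse (fun j x => cellMax (T.energy φ (ε j)) (x, D)) m
      (m + fun v => if v ∈ B then 0 else 1))
    {y : ι → ℤ} (hy : 0 ≤ y) (hyB : ∀ v ∈ B, y v = 0) :
    BoxCollapse (fun j x => cellMax (T.energy φ (ε j)) (x, D)) m
      (m + (fun v => if v ∈ B then 0 else 1) + y) := by
  induction hn : (∑ v, y v).toNat using Nat.strong_induction_on generalizing y with
  | _ n ih =>
    by_cases hy0 : y = 0
    · rw [hy0, add_zero]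
      exact H
    obtain ⟨v₀, hv₀⟩ := Function.ne_iff.1 hy0
    obtain ⟨v₁, -, hv₁⟩ := Finset.exists_max_image Finset.univ y ⟨v₀, Finset.mem_univ _⟩
    obtain ⟨v, hv, hdeep⟩ := Finset.exists_max_image (Finset.univ.filter fun v => y v = y v₁)
      T.depth ⟨v₁, by simp⟩
    simp only [Finset.mem_filter, Finset.mem_univ, true_and] at hv hdeep
    have hmax : ∀ w, y w ≤ y v := fun w => hv ▸ hv₁ w (Finset.mem_univ w)
    have hpos : 1 ≤ y v := by
      have h1 := hmax v₀
      have h2 : 0 ≤ y v₀ := hy v₀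
      have h3 : y v₀ ≠ 0 := hv₀
      omega
    have hvB : v ∉ B := fun h => by have := hyB v h; omega
    have hchild : ∀ w, T.par w = some v → y w + 1 ≤ y v := by
      intro w hw
      have h1 := hmax w
      have h2 : y w ≠ y v := fun h => by
        have := hdeep w (h.trans hv)
        have := T.depth_lt w v hw
        omega
      omega
    set b : ι → ℤ := m + (fun v => if v ∈ B then 0 else 1) + y with hb
    have hslope : 0 ≤ T.slope κ e 1 (corner b D - Pi.single v 1) v := by
      obtain ⟨δ, hδ⟩ : ∃ δ, corner b D - Pi.single v 1 = m + δ := ⟨_, (add_sub_cancel _ _).symm⟩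
      have hδv : ∀ w, δ w = (if w ∈ B then 0 else 1) + y w + (if w ∈ D then 1 else 0) -
          (if w = v then 1 else 0) := by
        intro w
        have := congrFun hδ w
        simp only [Pi.sub_apply, Pi.add_apply, corner_apply, hb, Pi.single_apply] at this
        omega
      have hvD : v ∉ D := fun h => hvB (hDB h)
      have h0 : δ v = y v := by rw [hδv]; simp [hvB, hvD]
      have hle : ∀ w, δ w ≤ 1 + y w := by
        intro w
        rw [hδv]
        by_cases hD : w ∈ D
        · have := hDB hD
          simp [hD, this]
          split_ifs <;> omega
        · simp only [hD, if_false]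
          split_ifs <;> omega
      have hpar : T.parVal 1 δ v ≤ 1 + y v * T.parVal 0 1 v := by
        unfold parVal
        cases h : T.par v with
        | none => simp
        | some p =>
          have h1 := hle p
          have h2 := hmax p
          simp
          omega
      have hch : T.childSum δ v ≤ y v * T.childSum 1 v := by
        have : y v * T.childSum 1 v = T.childSum (fun _ => y v) v := by
          simp only [childSum, Finset.mul_sum, mul_ite, Pi.one_apply, mul_one, mul_zero]
        rw [this]
        refine T.childSum_mono v fun w hw => ?_
        have h1 := hle w
        have h2 := hchild w hw
        omega
      have hs := T.slope_add κ e 0 1 m δ v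
      rw [zero_add] at hs
      rw [hδ, hs, h0]
      have h1 := hm v hvB
      have h2 := mul_le_mul_of_nonneg_left (hgood v hvB) (show 0 ≤ y v by omega)
      linarith
    have hstep : b - Pi.single v 1 = m + (fun v => if v ∈ B then 0 else 1) + (y - Pi.single v 1) :=
      add_sub_assoc _ _ _
    refine BoxCollapse.upper v ?_ (fun x _ hxb hx j => T.cellMax_energy_sub_single_le hφ (hε j)
      (fun h => hvB (hDB h)) hxb hx hslope) ?_
    · simp [hb, hvB]
      omega
    · rw [hstep]
      refine ih _ ?_ ?_ ?_ rfl
      · have h1 : ∑ w, (y - Pi.single v 1 : ι → ℤ) w = ∑ w, y w - 1 := by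
          simp only [Pi.sub_apply, Finset.sum_sub_distrib, Finset.sum_pi_single',
            Finset.mem_univ, if_true]
        have h2 : y v ≤ ∑ w, y w :=
          Finset.single_le_sum (fun w _ => hy w) (Finset.mem_univ v)
        rw [h1]
        omega
      · intro w
        by_cases hwv : w = v
        · subst hwv; simp; omega
        · simpa [hwv] using hy w
      · intro w hw
        have hwv : w ≠ v := fun h => hvB (h ▸ hw)
        simpa [hwv] using hyB w hw

/-- The increments in the direction `v` of the maxima of the energies over translates of the
`D`-face vary by at most one, as long as the coordinates at the proper descendants of `v` are
fixed and the coordinate at the parent of `v` varies by at most one (including the effect of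
`D`). -/
theorem cellMax_energy_increment_le (hvar : ∀ j, 0 ≤ ε j ∧ ε j ≤ 1) {x x' : ι → ℤ}
    {v : ι} (hvD : v ∉ D) (hv : x' v = x v)
    (hdesc : ∀ w, T.depth v < T.depth w → x' w = x w)
    (hpar : ∀ p, T.par v = some p → x' p + (if p ∈ D then 1 else 0) ≤ x p + 1) (j j' : κ') :
    cellMax (T.energy φ (ε j)) (x + Pi.single v 1, D) + cellMax (T.energy φ (ε j')) (x', D) ≤
      cellMax (T.energy φ (ε j)) (x, D) +
        cellMax (T.energy φ (ε j')) (x' + Pi.single v 1, D) + 1 := by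
  obtain ⟨J, hJ, hJe⟩ := exists_eq_cellMax (T.energy φ (ε j)) (x + Pi.single v 1) D
  obtain ⟨J', hJ', hJe'⟩ := exists_eq_cellMax (T.energy φ (ε j')) x' D
  obtain ⟨S, hvS, hS1, hS2, hS3⟩ := T.exists_descendants v
  have hvJ : v ∉ J := fun h => hvD (hJ h)
  have hvJ' : v ∉ J' := fun h => hvD (hJ' h)
  have hK : ∀ K K' : Finset ι, K ⊆ D → K' ⊆ D → (K ∩ S) ∪ (K' \ S) ⊆ D := fun K K' h h' =>
    Finset.union_subset (Finset.inter_subset_left.trans h) (Finset.sdiff_subset.trans h')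
  have hX : S.piecewise (corner x' J') (corner (x + Pi.single v 1) J) =
      corner x ((J' ∩ S) ∪ (J \ S)) := by
    ext u
    by_cases hu : u ∈ S
    · rw [Finset.piecewise_eq_of_mem _ _ _ hu]
      have : x' u = x u := by
        by_cases huv : u = v
        · rw [huv, hv]
        · exact hdesc u (hS3 u hu huv)
      simp [corner_apply, hu, this]
    · have huv : u ≠ v := fun h => hu (h ▸ hvS)
      simp [corner_apply, hu, huv]
  have hY : S.piecewise (corner (x + Pi.single v 1) J) (corner x' J') =
      corner (x' + Pi.single v 1) ((J ∩ S) ∪ (J' \ S)) := by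
    ext u
    by_cases hu : u ∈ S
    · rw [Finset.piecewise_eq_of_mem _ _ _ hu]
      have : x' u = x u := by
        by_cases huv : u = v
        · rw [huv, hv]
        · exact hdesc u (hS3 u hu huv)
      simp [corner_apply, hu, this]
    · have huv : u ≠ v := fun h => hu (h ▸ hvS)
      simp [corner_apply, hu, huv]
  have key := T.energy_add_energy_piecewise φ (ε j) (ε j') (corner (x + Pi.single v 1) J)
    (corner x' J') S hvS hS1 hS2
  rw [hX, hY] at key
  have h1 := le_cellMax (T.energy φ (ε j)) x (hK J' J hJ' hJ)
  have h2 := le_cellMax (T.energy φ (ε j')) (x' + Pi.single v 1) (hK J J' hJ hJ')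
  have h3 : corner x' J' v - corner (x + Pi.single v 1) J v = -1 := by
    simp [corner_apply, hvJ, hvJ', hv]
  have h4 : T.parVal (ε j') (corner x' J') v -
      T.parVal (ε j) (corner (x + Pi.single v 1) J) v ≤ 1 := by
    unfold parVal
    cases h : T.par v with
    | none =>
      have h1 := hvar j
      have h2 := hvar j'
      simp
      omega
    | some p =>
      have hp := hpar p h
      have hpv : p ≠ v := fun h' => T.par_ne_self v (h' ▸ h)
      have : p ∈ J' → p ∈ D := fun h => hJ' h
      simp only [Option.elim_some, corner_apply, Pi.add_apply, Pi.single_eq_of_ne hpv]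
      by_cases hpD : p ∈ D
      · simp only [hpD, if_true] at hp
        split_ifs <;> omega
      · have hpJ : p ∉ J := fun h => hpD (hJ h)
        have hpJ' : p ∉ J' := fun h => hpD (hJ' h)
        simp only [hpD, if_false] at hp
        simp only [hpJ, hpJ', if_false]
        omega
  rw [h3] at key
  rw [hJe, hJe']
  linarith

/-- A box with edges of length at most one, and of length zero in the directions of `B`, collapses
to a point. In the direction of largest depth, the increments of the energies vary by at most one;
being integers, they cannot have both signs. -/
theorem boxCollapse_of_cube (hvar : ∀ j, 0 ≤ ε j ∧ ε j ≤ 1) (hDB : D ⊆ B) {a b : ι → ℤ}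
    (hab : a ≤ b) (hba : ∀ v, b v ≤ a v + 1) (hB : ∀ v ∈ B, a v = b v) :
    BoxCollapse (fun j x => cellMax (T.energy φ (ε j)) (x, D)) a b := by
  induction hn : (∑ v, (b v - a v)).toNat using Nat.strong_induction_on generalizing a b with
  | _ n ih =>
    by_cases heq : a = b
    · rw [heq]
      exact BoxCollapse.point b
    obtain ⟨v₀, hv₀⟩ := Function.ne_iff.1 heq
    obtain ⟨v, hv, hdeep⟩ := Finset.exists_max_image (Finset.univ.filter fun v => a v ≠ b v)
      T.depth ⟨v₀, by simpa using hv₀⟩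
    simp only [Finset.mem_filter, Finset.mem_univ, true_and] at hv hdeep
    have hlt : a v < b v := lt_of_le_of_ne (hab v) hv
    have hbv : b v = a v + 1 := le_antisymm (hba v) hlt
    have hvB : v ∉ B := fun h => hv (hB v h)
    have hvD : v ∉ D := fun h => hvB (hDB h)
    have window : ∀ x x' : ι → ℤ, a ≤ x → x ≤ b → x v = a v → a ≤ x' → x' ≤ b → x' v = a v →
        ∀ j j', cellMax (T.energy φ (ε j)) (x + Pi.single v 1, D) +
          cellMax (T.energy φ (ε j')) (x', D) ≤ cellMax (T.energy φ (ε j)) (x, D) +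
            cellMax (T.energy φ (ε j')) (x' + Pi.single v 1, D) + 1 := by
      intro x x' hax hxb hx hax' hxb' hx' j j'
      refine T.cellMax_energy_increment_le hvar hvD (hx'.trans hx.symm) (fun w hw => ?_)
        (fun p hp => ?_) j j'
      · have h0 : a w = b w := by
          by_contra h
          exact absurd (hdeep w h) (not_le.2 hw)
        have h1 : a w ≤ x w := hax w
        have h2 : x w ≤ b w := hxb w
        have h3 : a w ≤ x' w := hax' w
        have h4 : x' w ≤ b w := hxb' w
        omega
      · have h0 := hba p
        have h1 : a p ≤ x p := hax p
        have h2 : x p ≤ b p := hxb p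
        have h3 : a p ≤ x' p := hax' p
        have h4 : x' p ≤ b p := hxb' p
        by_cases hpD : p ∈ D
        · have := hB p (hDB hpD)
          simp [hpD]
          omega
        · simp [hpD]
          omega
    have hle : b v - a v ≤ ∑ w, (b w - a w) :=
      Finset.single_le_sum (fun w _ => sub_nonneg.2 (hab w)) (Finset.mem_univ v)
    by_cases hup : ∃ x, a ≤ x ∧ x ≤ b ∧ x v = a v ∧ ∃ j, cellMax (T.energy φ (ε j)) (x, D) <
        cellMax (T.energy φ (ε j)) (x + Pi.single v 1, D)
    · obtain ⟨x, hax, hxb, hx, j, hj⟩ := hup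
      refine BoxCollapse.upper v hlt (fun x' hax' hxb' hx' j' => ?_) (ih _ ?_ ?_ ?_ ?_ rfl)
      · have := window x (x' - Pi.single v 1) hax hxb hx (fun w => ?_)
          (le_trans (fun w => ?_) hxb') (by simp; omega) j j'
        · rw [sub_add_cancel] at this
          omega
        · have h1 : a w ≤ x' w := hax' w
          by_cases hwv : w = v
          · subst hwv; simp; omega
          · simpa [hwv] using h1
        · by_cases hwv : w = v
          · subst hwv; simp
          · simp [hwv]
      · have h1 : ∑ w, ((b - Pi.single v 1 : ι → ℤ) w - a w) = ∑ w, (b w - a w) - 1 := by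
          simp only [Pi.sub_apply, Finset.sum_sub_distrib, Finset.sum_pi_single',
            Finset.mem_univ, if_true]
          ring
        rw [h1]
        omega
      · intro w
        by_cases hwv : w = v
        · subst hwv; simp; omega
        · simpa [hwv] using hab w
      · intro w
        have := hba w
        by_cases hwv : w = v
        · subst hwv; simp; omega
        · simpa [hwv] using this
      · intro w hw
        have hwv : w ≠ v := fun h => hvB (h ▸ hw)
        simpa [hwv] using hB w hw
    · push Not at hup
      refine BoxCollapse.lower v hlt (fun x hax hxb hx j => hup x hax hxb hx j)
        (ih _ ?_ ?_ ?_ ?_ rfl)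
      · have h1 : ∑ w, (b w - (a + Pi.single v 1 : ι → ℤ) w) = ∑ w, (b w - a w) - 1 := by
          simp only [Pi.add_apply, Finset.sum_sub_distrib, Finset.sum_add_distrib,
            Finset.sum_pi_single', Finset.mem_univ, if_true]
          ring
        rw [h1]
        omega
      · intro w
        by_cases hwv : w = v
        · subst hwv; simp; omega
        · simpa [hwv] using hab w
      · intro w
        have := hba w
        by_cases hwv : w = v
        · subst hwv; simp; omega
        · simpa [hwv] using this
      · intro w hw
        have hwv : w ≠ v := fun h => hvB (h ▸ hw)
        simpa [hwv] using hB w hw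

/-- Every box of length zero in the directions of `B` is contained in a collapsible one. -/
theorem exists_boxCollapse (hφ : ∀ v n, φ v (n + 1) - φ v n = κ v - e v * n)
    (hvar : ∀ j, 0 ≤ ε j ∧ ε j ≤ 1) (hDB : D ⊆ B)
    (hgood : ∀ v ∉ B, T.parVal 0 1 v + T.childSum 1 v ≤ -e v) {q : ι → ℤ} (hq : ∀ v, 1 ≤ q v)
    (hqe : ∀ v, e v * q v + T.parVal 0 q v + T.childSum q v ≤ -1) {a c : ι → ℤ} (hac : a ≤ c)
    (hB : ∀ v ∈ B, a v = c v) :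
    ∃ b, c ≤ b ∧ (∀ v ∈ B, a v = b v) ∧
      BoxCollapse (fun j x => cellMax (T.energy φ (ε j)) (x, D)) a b := by
  -- far out in the direction of `q`, restricted to the complement of `B`, all slopes are positive
  obtain ⟨N, hN0, hN⟩ : ∃ N : ℤ, 0 ≤ N ∧ ∀ v, 1 ≤ T.slope κ e 0 c v + N := by
    refine ⟨∑ v, |T.slope κ e 0 c v| + 1, by positivity, fun v => ?_⟩
    have h1 : |T.slope κ e 0 c v| ≤ ∑ v, |T.slope κ e 0 c v| :=
      Finset.single_le_sum (fun w _ => abs_nonneg (T.slope κ e 0 c w)) (Finset.mem_univ v)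
    have h2 := neg_abs_le (T.slope κ e 0 c v)
    omega
  let q' : ι → ℤ := fun v => if v ∈ B then 0 else q v
  have hq' : q' ≤ q := fun v => by
    have := hq v
    simp only [q']
    split_ifs <;> omega
  have hq0 : ∀ v, 0 ≤ q' v := fun v => by
    have := hq v
    simp only [q']
    split_ifs <;> omega
  set u : ι → ℤ := c + N • q' with hu
  have hcu : c ≤ u := fun v => by
    have := mul_nonneg hN0 (hq0 v)
    simp [hu]
    exact this
  have huB : ∀ v ∈ B, u v = c v := fun v hv => by simp [hu, q', hv]
  have hslope : ∀ v ∉ B, 1 ≤ T.slope κ e 0 u v := by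
    intro v hv
    have h1 := T.slope_add κ e 0 0 c (N • q') v
    have h2 : T.parVal 0 (N • q') v = N * T.parVal 0 q' v := by
      unfold parVal
      cases T.par v <;> simp
    have h3 : T.childSum (N • q') v = N * T.childSum q' v := by
      simp [childSum, Finset.mul_sum]
    have h4 := T.parVal_mono (le_refl (0 : ℤ)) hq' v
    have h5 := T.childSum_mono v fun w _ => hq' w
    have h6 := hqe v
    have h7 : q' v = q v := by simp [q', hv]
    have h8 := hN v
    rw [zero_add] at h1
    rw [hu, h1, h2, h3]
    have h9 : (N • q') v = N * q v := by simp [h7]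
    rw [h9]
    nlinarith
  refine ⟨u + fun v => if v ∈ B then 0 else 1, fun v => ?_, fun v hv => ?_, ?_⟩
  · have : c v ≤ u v := hcu v
    simp only [Pi.add_apply]
    split_ifs <;> omega
  · simp [hv, huB v hv, hB v hv]
  refine T.boxCollapse_of_lower hφ (fun j => (hvar j).1) hDB hslope (fun v => ?_)
    (fun m hmu hmB hm => ?_) (hac.trans hcu) (fun v hv => (hB v hv).trans (huB v hv).symm)
  · simp only [Pi.add_apply]
    split_ifs <;> omega
  · have hb : u + (fun v => if v ∈ B then 0 else 1) =
        m + (fun v => if v ∈ B then 0 else 1) + (u - m) := by abel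
    rw [hb]
    refine T.boxCollapse_of_upper hφ (fun j => (hvar j).2) hDB hm hgood
      (T.boxCollapse_of_cube hvar hDB (fun v => ?_) (fun v => ?_) fun v hv => ?_)
      (sub_nonneg.2 hmu) fun v hv => ?_
    · simp only [Pi.add_apply]
      split_ifs <;> omega
    · simp only [Pi.add_apply]
      split_ifs <;> omega
    · simp [hv]
    · simp [hmB v hv]

end Collapse

end RootedForest

/-! ### Vanishing of homology in high degrees -/

namespace CubicalLattice

open Finsupp

variable {ι : Type*} [Fintype ι] [DecidableEq ι]

theorem partialBoundary_filter {S : Finset ι} {P : Cell ι → Prop} [DecidablePred P]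
    (hP : ∀ ℓ I w, w ∈ I → w ∉ S →
      ((P (ℓ, I.erase w) ↔ P (ℓ, I)) ∧ (P (ℓ + Pi.single w 1, I.erase w) ↔ P (ℓ, I))))
    (z : Chain ι) : partialBoundary S (z.filter P) = (partialBoundary S z).filter P := by
  ext ⟨ℓ, K⟩
  rw [Finsupp.filter_apply, partialBoundary_apply, partialBoundary_apply]
  have h : ∀ v ∈ (K ∪ S)ᶜ, (P (ℓ, insert v K) ↔ P (ℓ, K)) ∧
      (P (ℓ - Pi.single v 1, insert v K) ↔ P (ℓ, K)) := by
    intro v hv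
    simp only [Finset.mem_compl, Finset.mem_union, not_or] at hv
    have h1 := (hP ℓ (insert v K) v (Finset.mem_insert_self _ _) hv.2).1
    have h2 := (hP (ℓ - Pi.single v 1) (insert v K) v (Finset.mem_insert_self _ _) hv.2).2
    rw [Finset.erase_insert hv.1] at h1 h2
    rw [sub_add_cancel] at h2
    exact ⟨h1.symm, h2.symm⟩
  split_ifs with hK
  · refine Finset.sum_congr rfl fun v hv => ?_
    rw [Finsupp.filter_apply_pos _ _ ((h v hv).1.2 hK),
      Finsupp.filter_apply_pos _ _ ((h v hv).2.2 hK)]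
  · refine Finset.sum_eq_zero fun v hv => ?_
    rw [Finsupp.filter_apply_neg _ _ (fun h' => hK ((h v hv).1.1 h')),
      Finsupp.filter_apply_neg _ _ (fun h' => hK ((h v hv).2.1 h')), add_zero]

/-- The coordinates of `ℓ` in the directions of `B`, extended by zero. -/
def restrictTo (B : Finset ι) (ℓ : ι → ℤ) : ι → ℤ := fun v => if v ∈ B then ℓ v else 0

omit [Fintype ι] in
theorem restrictTo_add_single_of_notMem {B : Finset ι} {v : ι} (hv : v ∉ B) (ℓ : ι → ℤ) :
    restrictTo B (ℓ + Pi.single v 1) = restrictTo B ℓ := by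
  ext w
  by_cases hw : w = v
  · subst hw; simp [restrictTo, hv]
  · simp [restrictTo, hw]

omit [Fintype ι] in
theorem restrictTo_add_single_of_mem {B : Finset ι} {v : ι} (hv : v ∈ B) (ℓ : ι → ℤ) :
    restrictTo B (ℓ + Pi.single v 1) = restrictTo B ℓ + Pi.single v 1 := by
  ext w
  by_cases hw : w = v
  · subst hw; simp [restrictTo, hv]
  · simp [restrictTo, hw]

omit [Fintype ι] in
theorem erase_inter_of_notMem {B I : Finset ι} {v : ι} (hv : v ∉ B) : I.erase v ∩ B = I ∩ B := by
  rw [Finset.erase_inter, Finset.erase_eq_of_notMem fun h => hv (Finset.mem_inter.1 h).2]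

open scoped Classical in
/-- The sum of the coefficients at the cells with the property `P`. -/
noncomputable def coeffSumOn (P : Cell ι → Prop) : Chain ι →ₗ[ZMod 2] ZMod 2 :=
  Finsupp.linearCombination (ZMod 2) fun c : Cell ι => if P c then (1 : ZMod 2) else 0

omit [Fintype ι] [DecidableEq ι] in
theorem coeffSumOn_single (P : Cell ι → Prop) (c : Cell ι) [Decidable (P c)] :
    coeffSumOn P (single c 1) = if P c then 1 else 0 := by
  simp only [coeffSumOn, Finsupp.linearCombination_single, one_smul]
  congr

omit [Fintype ι] [DecidableEq ι] in
theorem coeffSum_filter (P : Cell ι → Prop) [DecidablePred P] (z : Chain ι) :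
    coeffSum (z.filter P) = coeffSumOn P z := by
  simp only [coeffSum, coeffSumOn, Finsupp.linearCombination_apply, Finsupp.sum,
    Finsupp.support_filter, Finset.sum_filter, smul_eq_mul, mul_ite, mul_one, mul_zero]
  refine Finset.sum_congr rfl fun c _ => ?_
  by_cases h : P c
  · simp [h]
  · simp [h]

omit [Fintype ι] [DecidableEq ι] in
theorem exists_of_coeffSumOn_ne_zero {P : Cell ι → Prop} {z : Chain ι} (h : coeffSumOn P z ≠ 0) :
    ∃ x, P x ∧ z x ≠ 0 := by
  classical
  rw [coeffSumOn, Finsupp.linearCombination_apply, Finsupp.sum] at h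
  obtain ⟨x, hx, hne⟩ := Finset.exists_ne_zero_of_sum_ne_zero h
  refine ⟨x, by_contra fun hP => hne ?_, Finsupp.mem_support_iff.1 hx⟩
  simp [hP]

/-- The boundary commutes with the projection onto the coordinates in `B`. Besides the cells with
directions `B`, only those with directions `B \ {b} ∪ {v}`, `v ∉ B`, have faces with directions
`B \ {b}`, and their two faces of this kind have the same projection. -/
theorem coeffSumOn_partialBoundary {B : Finset ι} {b : ι} (hb : b ∈ B) (β : ι → ℤ) (z : Chain ι) :
    coeffSumOn (fun x => x.2 = B.erase b ∧ restrictTo B x.1 = β) (partialBoundary ∅ z) =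
      coeffSumOn (fun x => x.2 = B ∧ restrictTo B x.1 = β) z +
        coeffSumOn (fun x => x.2 = B ∧ restrictTo B x.1 = β - Pi.single b 1) z := by
  classical
  suffices h : coeffSumOn (fun x => x.2 = B.erase b ∧ restrictTo B x.1 = β) ∘ₗ
      partialBoundary ∅ = coeffSumOn (fun x => x.2 = B ∧ restrictTo B x.1 = β) +
        coeffSumOn (fun x => x.2 = B ∧ restrictTo B x.1 = β - Pi.single b 1) from
    LinearMap.congr_fun h z
  refine Finsupp.lhom_ext' fun c => LinearMap.ext_ring ?_
  obtain ⟨ℓ, I⟩ := c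
  simp only [LinearMap.coe_comp, Function.comp_apply, lsingle_apply, LinearMap.add_apply]
  rw [partialBoundary_single, map_sum]
  simp only [map_add, coeffSumOn_single, Finset.sdiff_empty]
  have other : ∀ v ∈ I, v ≠ b →
      ((if I.erase v = B.erase b ∧ restrictTo B ℓ = β then (1 : ZMod 2) else 0) +
        if I.erase v = B.erase b ∧ restrictTo B (ℓ + Pi.single v 1) = β then 1 else 0) = 0 := by
    intro v hv hvb
    by_cases hI : I.erase v = B.erase b
    · have hvB : v ∉ B := fun h =>
        Finset.notMem_erase v I (hI ▸ Finset.mem_erase.2 ⟨hvb, h⟩)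
      rw [restrictTo_add_single_of_notMem hvB]
      exact CharTwo.add_self_eq_zero _
    · simp [hI]
  by_cases hbI : b ∈ I
  · rw [Finset.sum_eq_single_of_mem b hbI fun v hv hvb => other v hv hvb,
      restrictTo_add_single_of_mem hb]
    have h1 : I.erase b = B.erase b ↔ I = B := by
      constructor
      · intro h
        rw [← Finset.insert_erase hbI, h, Finset.insert_erase hb]
      · rintro rfl
        rfl
    simp only [h1, eq_sub_iff_add_eq]
  · rw [Finset.sum_eq_zero fun v hv => other v hv fun h => hbI (h ▸ hv)]
    have hIB : I ≠ B := fun h => hbI (h ▸ hb)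
    simp [hIB]

/-- A finite cycle of dimension `|B|` projects to zero along the directions of `B`, since the
projection is a finite cycle of top dimension. -/
theorem coeffSumOn_eq_zero_of_cycle {B : Finset ι} {z : Chain ι} {C : Set (Cell ι)}
    (hz : SupportedOn C B.card z) (hbz : partialBoundary ∅ z = 0)
    (h0 : B.card = 0 → coeffSum z = 0) (β : ι → ℤ) :
    coeffSumOn (fun x => x.2 = B ∧ restrictTo B x.1 = β) z = 0 := by
  classical
  rcases B.eq_empty_or_nonempty with rfl | ⟨b, hb⟩
  · by_cases hβ : β = 0
    · rw [← coeffSum_filter, Finsupp.filter_eq_self_iff _ _ |>.2]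
      · exact h0 rfl
      · intro x hx
        exact ⟨Finset.card_eq_zero.1 (hz x hx).2, hβ ▸ rfl⟩
    · by_contra h
      obtain ⟨x, hx, -⟩ := exists_of_coeffSumOn_ne_zero h
      exact hβ hx.2.symm
  · by_contra hne
    -- the projection is invariant under translation in the direction `b`
    have hshift : ∀ n : ℕ, coeffSumOn (fun x => x.2 = B ∧
        restrictTo B x.1 = β - n • Pi.single b 1) z ≠ 0 := by
      intro n
      induction n with
      | zero => simpa using hne
      | succ n ih =>
        have h := coeffSumOn_partialBoundary hb (β - n • Pi.single b 1) z
        rw [hbz, map_zero, sub_sub, ← succ_nsmul] at h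
        intro h'
        rw [h', add_zero] at h
        exact ih h.symm
    obtain ⟨x, hx, hzx⟩ := exists_of_coeffSumOn_ne_zero
      (hshift ((β b).natAbs + ∑ x ∈ z.support, (x.1 b).natAbs + 1))
    have h1 := congrFun hx.2 b
    have h2 : (x.1 b).natAbs ≤ ∑ x ∈ z.support, (x.1 b).natAbs :=
      Finset.single_le_sum (f := fun x : Cell ι => (x.1 b).natAbs) (fun _ _ => Nat.zero_le _)
        (Finsupp.mem_support_iff.2 hzx)
    generalize ∑ x ∈ z.support, (x.1 b).natAbs = N at h1 h2
    have h3 := le_abs_self (β b)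
    simp [restrictTo, hb] at h1
    omega

section Vanishing

variable {κ : Type*} {f : κ → (ι → ℤ) → ℤ} {B : Finset ι} {C : Set (Cell ι)}

/-- Cycles for the boundary in the directions outside `B` that lie in a single fibre of the
projection along `B` are boundaries. -/
theorem exists_bounding_chain_of_fibre
    (hC : ∀ c c', (∀ j, cellMax (f j) c' ≤ cellMax (f j) c) → c ∈ C → c' ∈ C) {D : Finset ι}
    (hcol : ∀ a c : ι → ℤ, a ≤ c → (∀ v ∈ B, a v = c v) → ∃ b, c ≤ b ∧ (∀ v ∈ B, a v = b v) ∧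
      BoxCollapse (fun j x => cellMax (f j) (x, D)) a b) {β : ι → ℤ}
    {p : ℕ} {z : Chain ι} (hz : SupportedOn C p z)
    (hfib : ∀ x, z x ≠ 0 → x.2 ∩ B = D ∧ restrictTo B x.1 = β)
    (hbz : partialBoundary B z = 0) (hsum : p = D.card → coeffSum z = 0) :
    ∃ y, SupportedOn C (p + 1) y ∧ (∀ x, y x ≠ 0 → x.2 ∩ B = D) ∧ partialBoundary B y = z := by
  classical
  obtain ⟨N, hN⟩ : ∃ N : ℤ, ∀ x, z x ≠ 0 → ∀ v, |x.1 v| ≤ N := by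
    refine ⟨∑ x ∈ z.support, ∑ v, |x.1 v|, fun x hx v => ?_⟩
    exact (Finset.single_le_sum (f := fun v => |x.1 v|) (fun _ _ => abs_nonneg _)
      (Finset.mem_univ v)).trans (Finset.single_le_sum (f := fun x : Cell ι => ∑ v, |x.1 v|)
        (fun _ _ => Finset.sum_nonneg fun _ _ => abs_nonneg _) (Finsupp.mem_support_iff.2 hx))
  obtain ⟨b, hcb, hB, hab⟩ := hcol (fun v => if v ∈ B then β v else -|N|)
    (fun v => if v ∈ B then β v else |N| + 1)
    (fun v => by have := abs_nonneg N; simp only; split_ifs <;> omega) (fun v hv => by simp [hv])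
  have hbox : SupportedOn (C ∩ boxCells B D (fun v => if v ∈ B then β v else -|N|) b) p z := by
    refine fun x hx => ⟨⟨(hz x hx).1, (hfib x hx).1, fun v => ?_, fun v => ?_⟩, (hz x hx).2⟩
    · have h1 := hN x hx v
      have h2 := congrFun (hfib x hx).2 v
      have h3 := neg_abs_le (x.1 v)
      have h4 := le_abs_self N
      by_cases hv : v ∈ B
      · simp [restrictTo, hv] at h2 ⊢
        omega
      · simp only [hv, if_false]
        omega
    · have h1 := hN x hx v
      have h2 := congrFun (hfib x hx).2 v
      have h3 := le_abs_self (x.1 v)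
      have h4 := le_abs_self N
      refine le_trans ?_ (hcb v)
      by_cases hv : v ∈ B
      · simp [restrictTo, hv, corner_apply] at h2 ⊢
        omega
      · simp only [corner_apply, hv, if_false]
        split_ifs <;> omega
  obtain ⟨y, hy, hyz⟩ := exists_bounding_chain_of_boxCollapse hC hab hB hbox hbz hsum
  exact ⟨y, hy.mono Set.inter_subset_left, fun x hx => (hy x hx).1.2.1, hyz⟩

/-- Cycles for the boundary in the directions outside `B` are boundaries, provided that their
sums over the fibres consisting of cells of the same dimension vanish. -/
theorem exists_bounding_chain_of_partialBoundary_eq_zero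
    (hC : ∀ c c', (∀ j, cellMax (f j) c' ≤ cellMax (f j) c) → c ∈ C → c' ∈ C)
    (hcol : ∀ D ⊆ B, ∀ a c : ι → ℤ, a ≤ c → (∀ v ∈ B, a v = c v) →
      ∃ b, c ≤ b ∧ (∀ v ∈ B, a v = b v) ∧ BoxCollapse (fun j x => cellMax (f j) (x, D)) a b)
    {m p : ℕ} {z : Chain ι} (hz : SupportedOn C p z) (hm : ∀ x, z x ≠ 0 → (x.2 ∩ B).card = m)
    (hbz : partialBoundary B z = 0)
    (hsum : ∀ D β, p = D.card →
      coeffSumOn (fun x => x.2 ∩ B = D ∧ restrictTo B x.1 = β) z = 0) :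
    ∃ y, SupportedOn C (p + 1) y ∧ (∀ x, y x ≠ 0 → (x.2 ∩ B).card = m) ∧
      partialBoundary B y = z := by
  classical
  let π : Cell ι → Finset ι × (ι → ℤ) := fun x => (x.2 ∩ B, restrictTo B x.1)
  have hπ : ∀ q : Finset ι × (ι → ℤ), ∀ x, π x = q ↔ x.2 ∩ B = q.1 ∧ restrictTo B x.1 = q.2 :=
    fun q x => Prod.ext_iff
  have hfibre : ∀ q : Finset ι × (ι → ℤ), ∃ y, SupportedOn C (p + 1) y ∧
      (∀ x, y x ≠ 0 → (x.2 ∩ B).card = m) ∧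
      partialBoundary B y = z.filter (fun x => π x = q) := by
    intro q
    have hfilt : ∀ x, z.filter (fun x => π x = q) x ≠ 0 → π x = q ∧ z x ≠ 0 := by
      intro x hx
      rw [Finsupp.filter_apply] at hx
      simpa using hx
    by_cases hex : ∃ x, z.filter (fun x => π x = q) x ≠ 0
    · obtain ⟨x₀, hx₀⟩ := hex
      have hq := (hπ q x₀).1 (hfilt x₀ hx₀).1
      have hqB : q.1 ⊆ B := hq.1 ▸ Finset.inter_subset_right
      obtain ⟨y, hy1, hy2, hy3⟩ := exists_bounding_chain_of_fibre hC (hcol q.1 hqB) (β := q.2)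
        (z := z.filter (fun x => π x = q)) (p := p)
        (fun x hx => hz x (hfilt x hx).2) (fun x hx => (hπ q x).1 (hfilt x hx).1)
        (by
          rw [partialBoundary_filter, hbz, Finsupp.filter_zero]
          intro ℓ I w _ hw
          simp only [hπ, erase_inter_of_notMem hw, restrictTo_add_single_of_notMem hw, and_self])
        (fun hp => by
          rw [coeffSum_filter]
          simp only [hπ]
          exact hsum q.1 q.2 hp)
      refine ⟨y, hy1, fun x hx => ?_, hy3⟩
      rw [hy2 x hx, ← hq.1]
      exact hm x₀ (hfilt x₀ hx₀).2
    · push Not at hex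
      refine ⟨0, fun x hx => absurd rfl hx, fun x hx => absurd rfl hx, ?_⟩
      rw [map_zero]
      exact (Finsupp.ext hex).symm
  choose y hy1 hy2 hy3 using hfibre
  have hne : ∀ x, (∑ q ∈ z.support.image π, y q) x ≠ 0 → ∃ q, y q x ≠ 0 := by
    intro x hx
    rw [Finsupp.finsetSum_apply] at hx
    obtain ⟨q, -, hq⟩ := Finset.exists_ne_zero_of_sum_ne_zero hx
    exact ⟨q, hq⟩
  refine ⟨∑ q ∈ z.support.image π, y q, fun x hx => ?_, fun x hx => ?_, ?_⟩
  · obtain ⟨q, hq⟩ := hne x hx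
    exact hy1 q x hq
  · obtain ⟨q, hq⟩ := hne x hx
    exact hy2 q x hq
  · rw [map_sum]
    simp only [hy3]
    ext x
    rw [Finsupp.finsetSum_apply]
    simp only [Finsupp.filter_apply]
    rw [Finset.sum_ite_eq]
    split_ifs with h
    · rfl
    · by_contra h'
      exact h (Finset.mem_image_of_mem π (Finsupp.mem_support_iff.2 (Ne.symm h')))

/-- If all fibres of the projection along `B` collapse, then there is no reduced homology in the
degrees `p ≥ |B|`. The cycle is pushed step by step into the cells with fewer directions in `B`.
-/
theorem exists_bounding_chain
    (hC : ∀ c c', (∀ j, cellMax (f j) c' ≤ cellMax (f j) c) → c ∈ C → c' ∈ C)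
    (hcol : ∀ D ⊆ B, ∀ a c : ι → ℤ, a ≤ c → (∀ v ∈ B, a v = c v) →
      ∃ b, c ≤ b ∧ (∀ v ∈ B, a v = b v) ∧ BoxCollapse (fun j x => cellMax (f j) (x, D)) a b)
    {p : ℕ} (hp : B.card ≤ p) {z : Chain ι} (hz : SupportedOn C p z)
    (hbz : partialBoundary ∅ z = 0) (h0 : p = 0 → coeffSum z = 0) :
    ∃ y, SupportedOn C (p + 1) y ∧ partialBoundary ∅ y = z := by
  classical
  have hCface := faceClosed_of_cellMax (f := f) ∅ hC
  suffices h : ∀ m : ℕ, ∀ z : Chain ι, SupportedOn C p z → partialBoundary ∅ z = 0 →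
      (p = 0 → coeffSum z = 0) → (∀ x, z x ≠ 0 → (x.2 ∩ B).card < m) →
      ∃ y, SupportedOn C (p + 1) y ∧ partialBoundary ∅ y = z from
    h (B.card + 1) z hz hbz h0 fun x _ =>
      Nat.lt_succ_of_le (Finset.card_le_card Finset.inter_subset_right)
  intro m
  induction m with
  | zero =>
    intro z _ _ _ hm
    refine ⟨0, fun x hx => absurd rfl hx, ?_⟩
    rw [map_zero]
    ext x
    by_contra h
    exact absurd (hm x (Ne.symm h)) (Nat.not_lt_zero _)
  | succ m ih =>
    intro z hz hbz h0 hm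
    let w : Chain ι := z.filter fun x => (x.2 ∩ B).card = m
    have hw : ∀ x, w x ≠ 0 → (x.2 ∩ B).card = m ∧ z x ≠ 0 := by
      intro x hx
      simp only [w, Finsupp.filter_apply] at hx
      simpa using hx
    -- in the cells with `m` directions in `B`, only faces in the other directions matter
    have hbw : partialBoundary B w = 0 := by
      rw [partialBoundary_filter fun ℓ I v _ hv => by
        simp only [erase_inter_of_notMem hv, and_self]]
      ext ⟨ℓ, K⟩
      rw [Finsupp.filter_apply, Finsupp.zero_apply]
      split_ifs with hK
      · simp only at hK
        have h := DFunLike.congr_fun hbz (ℓ, K)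
        rw [partialBoundary_apply, Finsupp.zero_apply] at h
        rw [partialBoundary_apply, ← h]
        refine Finset.sum_subset ?_ fun v hv hv' => ?_
        · exact Finset.compl_subset_compl.2 (Finset.union_subset_union le_rfl (by simp))
        · have hvK : v ∉ K := by simpa using hv
          have hvB : v ∈ B := by
            simp only [Finset.mem_compl, Finset.mem_union, not_not] at hv'
            tauto
          have hcard : (insert v K ∩ B).card = m + 1 := by
            rw [Finset.insert_inter_of_mem hvB, Finset.card_insert_of_notMem, hK]
            simp [hvK]
          have hz0 : ∀ ℓ, z (ℓ, insert v K) = 0 := by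
            intro ℓ
            by_contra h
            have := hm _ h
            simp only at this
            omega
          rw [hz0, hz0, add_zero]
      · rfl
    have hsum : ∀ D β, p = D.card →
        coeffSumOn (fun x => x.2 ∩ B = D ∧ restrictTo B x.1 = β) w = 0 := by
      intro D β hD
      by_cases hpB : p = B.card
      · subst hpB
        by_contra hne
        obtain ⟨x₀, hx₀, hwx₀⟩ := exists_of_coeffSumOn_ne_zero hne
        have hDB : D = B := Finset.eq_of_subset_of_card_le (hx₀.1 ▸ Finset.inter_subset_right)
          hD.le
        have hmB : m = B.card := by rw [← (hw x₀ hwx₀).1, hx₀.1, hDB]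
        have htop : ∀ x, z x ≠ 0 → (x.2 ∩ B = B ↔ x.2 = B) := by
          intro x hx
          constructor
          · intro h
            exact (Finset.eq_of_subset_of_card_le (Finset.inter_eq_right.1 h)
              (hz x hx).2.le).symm
          · intro h
            rw [h, Finset.inter_self]
        have hzero := coeffSumOn_eq_zero_of_cycle hz hbz h0 β
        apply hne
        rw [← hzero, ← coeffSum_filter, ← coeffSum_filter]
        congr 1
        ext x
        simp only [w, Finsupp.filter_apply, hDB]
        by_cases hx : z x = 0
        · simp [hx]
        · have h1 := htop x hx
          by_cases h2 : x.2 = B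
          · simp [h2, hmB]
          · have h3 : ¬x.2 ∩ B = B := fun h => h2 (h1.1 h)
            simp [h2, h3]
      · by_contra hne
        obtain ⟨x₀, hx₀, -⟩ := exists_of_coeffSumOn_ne_zero hne
        have : D.card ≤ B.card := Finset.card_le_card (hx₀.1 ▸ Finset.inter_subset_right)
        omega
    obtain ⟨y, hy1, hy2, hy3⟩ := exists_bounding_chain_of_partialBoundary_eq_zero hC hcol
      (m := m) (p := p) (z := w) (fun x hx => hz x (hw x hx).2) (fun x hx => (hw x hx).1) hbw hsum
    have hlt : ∀ x, (z + partialBoundary ∅ y) x ≠ 0 → (x.2 ∩ B).card < m := by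
      rintro ⟨ℓ, K⟩ hx
      by_contra hge
      simp only [not_lt] at hge
      apply hx
      rw [Finsupp.add_apply]
      -- the cofaces in the directions of `B` have too many directions in `B`
      have hB : partialBoundary ∅ y (ℓ, K) = partialBoundary B y (ℓ, K) := by
        rw [partialBoundary_apply, partialBoundary_apply]
        symm
        refine Finset.sum_subset ?_ fun v hv hv' => ?_
        · exact Finset.compl_subset_compl.2 (Finset.union_subset_union le_rfl (by simp))
        · have hvK : v ∉ K := by simpa using hv
          have hvB : v ∈ B := by
            simp only [Finset.mem_compl, Finset.mem_union, not_not] at hv'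
            tauto
          have hcard : (insert v K ∩ B).card = (K ∩ B).card + 1 := by
            rw [Finset.insert_inter_of_mem hvB, Finset.card_insert_of_notMem]
            simp [hvK]
          have hy0 : ∀ ℓ, y (ℓ, insert v K) = 0 := by
            intro ℓ
            by_contra h
            have := hy2 _ h
            simp only at this
            omega
          rw [hy0, hy0, add_zero]
      rw [hB, hy3]
      simp only [w, Finsupp.filter_apply]
      split_ifs with h
      · exact CharTwo.add_self_eq_zero _
      · rw [add_zero]
        by_contra hz'
        have := hm _ hz'
        simp only at this
        omega
    obtain ⟨y', hy', hyz'⟩ := ih (z + partialBoundary ∅ y)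
      (hz.add (hy1.partialBoundary hCface))
      (by rw [map_add, hbz, partialBoundary_partialBoundary, add_zero])
      (fun h => by rw [map_add, h0 h, coeffSum_partialBoundary, add_zero]) hlt
    refine ⟨y + y', hy1.add hy', ?_⟩
    rw [map_add, hyz', add_comm z, ← add_assoc, ZModModule.add_self, zero_add]

end Vanishing

end CubicalLattice

/-! ### Negative definite forms with nonnegative off-diagonal entries -/

section Matrix

open Matrix

/-- For a negative definite integral form with nonnegative off-diagonal entries there is a
strictly positive vector whose product with each basis vector is negative. -/
theorem exists_one_le_mulVec_le_neg_one {ι : Type*} [Fintype ι] [DecidableEq ι]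
    (M : Matrix ι ι ℤ) (hoff : ∀ v w, v ≠ w → 0 ≤ M v w)
    (hneg : ∀ x : ι → ℤ, x ≠ 0 → x ⬝ᵥ M *ᵥ x < 0) :
    ∃ q : ι → ℤ, (∀ v, 1 ≤ q v) ∧ ∀ v, (M *ᵥ q) v ≤ -1 := by
  have hdet : M.det ≠ 0 := by
    intro h
    obtain ⟨x, hx, hMx⟩ := Matrix.exists_mulVec_eq_zero_iff.2 h
    have := hneg x hx
    rw [hMx, dotProduct_zero] at this
    exact lt_irrefl _ this
  -- solve `M q = -det(M)² • 1`
  let q : ι → ℤ := -M.det • (M.adjugate *ᵥ 1)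
  have hq : ∀ v, (M *ᵥ q) v = -(M.det * M.det) := by
    intro v
    have : M *ᵥ q = -M.det • (M.det • (1 : ι → ℤ)) := by
      simp only [q]
      rw [mulVec_smul, mulVec_mulVec, mul_adjugate, smul_mulVec, one_mulVec]
    rw [this]
    simp
  have hpos : 1 ≤ M.det * M.det := by
    have := mul_self_pos.2 hdet
    omega
  have hle : ∀ v, (M *ᵥ q) v ≤ -1 := fun v => by rw [hq]; omega
  -- the negative part `r` of `q` vanishes, as otherwise `r ⬝ᵥ M q` would be positive
  let r : ι → ℤ := fun v => max (-q v) 0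
  let s : ι → ℤ := fun v => max (q v) 0
  have hqrs : q = s - r := by
    ext v
    simp only [s, r, Pi.sub_apply]
    omega
  have hr : ∀ v, 0 ≤ r v := fun v => le_max_right _ _
  have hs : ∀ v, 0 ≤ s v := fun v => le_max_right _ _
  have hrs : 0 ≤ r ⬝ᵥ M *ᵥ s := by
    refine Finset.sum_nonneg fun v _ => ?_
    simp only [mulVec, dotProduct, Finset.mul_sum]
    refine Finset.sum_nonneg fun w _ => ?_
    by_cases hvw : v = w
    · subst hvw
      have : r v = 0 ∨ s v = 0 := by
        simp only [s, r]
        omega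
      rcases this with h | h <;> simp [h]
    · exact mul_nonneg (hr v) (mul_nonneg (hoff v w hvw) (hs w))
  have hr0 : r = 0 := by
    by_contra hne
    have h1 := hneg r hne
    have h2 : r ⬝ᵥ M *ᵥ q = r ⬝ᵥ M *ᵥ s - r ⬝ᵥ M *ᵥ r := by
      rw [hqrs, mulVec_sub, dotProduct_sub]
    have h3 : r ⬝ᵥ M *ᵥ q ≤ 0 :=
      Finset.sum_nonpos fun v _ => mul_nonpos_of_nonneg_of_nonpos (hr v) (by
        have := hle v
        omega)
    omega
  have hq0 : ∀ v, 0 ≤ q v := fun v => by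
    have : r v = 0 := congrFun hr0 v
    simp only [r] at this
    omega
  refine ⟨q, fun v => ?_, hle⟩
  by_contra hlt
  have hqv : q v = 0 := by
    have := hq0 v
    omega
  have h1 := hle v
  have h2 : 0 ≤ (M *ᵥ q) v := by
    refine Finset.sum_nonneg fun w _ => ?_
    by_cases hvw : v = w
    · rw [← hvw, hqv, mul_zero]
    · exact mul_nonneg (hoff v w hvw) (hq0 w)
  omega

end Matrix

/-! ### The plumbing tree as a rooted forest -/

namespace KnotPlumbing

open CubicalLattice

variable {V : Type*} [Fintype V] [DecidableEq V] (Γ : KnotPlumbing V)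

omit [Fintype V] [DecidableEq V] in
/-- In a tree, each vertex other than the root has a unique neighbour closer to the root. -/
theorem existsUnique_adj_dist_lt {G : SimpleGraph V} (hG : G.IsTree) (r : V) {v : V}
    (hv : v ≠ r) : ∃! u, G.Adj v u ∧ G.dist r u < G.dist r v := by
  obtain ⟨p, hp⟩ := (hG.connected.preconnected r v).exists_walk_length_eq_dist
  have hnil : ¬p.Nil := fun h => hv h.eq.symm
  refine ⟨p.penultimate, ⟨(p.adj_penultimate hnil).symm, ?_⟩, ?_⟩
  · have h1 : G.dist r p.penultimate ≤ p.dropLast.length := SimpleGraph.dist_le _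
    have h2 : p.dropLast.length + 1 = p.length := SimpleGraph.Walk.length_dropLast_add_one hnil
    omega
  · rintro u ⟨hvu, hu⟩
    obtain ⟨p', hp'⟩ := (hG.connected.preconnected r u).exists_walk_length_eq_dist
    have h1 : (p'.concat hvu.symm).length = G.dist r v := by
      have h2 : G.dist r v ≤ (p'.concat hvu.symm).length := SimpleGraph.dist_le _
      rw [SimpleGraph.Walk.length_concat] at h2 ⊢
      omega
    have h2 := (hG.existsUnique_path r v).unique
      ((p'.concat hvu.symm).isPath_of_length_eq_dist h1) (p.isPath_of_length_eq_dist hp)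
    rw [← h2, SimpleGraph.Walk.penultimate_concat]

theorem exists_rootedForest : ∃ T : RootedForest Γ.Vert,
    (∀ v w, Γ.framedGraph.Adj v w ↔ T.par v = some w ∨ T.par w = some v) ∧
    ∀ v : Γ.Vert, Γ.graph.Adj Γ.root v ↔ T.par v = none := by
  choose P hP hPu using fun v : Γ.Vert => existsUnique_adj_dist_lt Γ.isTree Γ.root v.2
  have hpar : ∀ v w : Γ.Vert,
      (if h : P v = Γ.root then none else some (⟨P v, h⟩ : Γ.Vert)) = some w ↔ P v = w := by
    intro v w
    split_ifs with h
    · simp only [false_iff]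
      intro h'
      exact w.2 (h'.symm.trans h)
    · simp [Subtype.ext_iff]
  refine ⟨⟨fun v => if h : P v = Γ.root then none else some ⟨P v, h⟩,
    fun v => Γ.graph.dist Γ.root v, fun v p h => ?_⟩, fun v w => ?_, fun v => ?_⟩
  · rw [hpar] at h
    rw [← h]
    exact (hP v).2
  · simp only [hpar]
    change Γ.graph.Adj v w ↔ _
    constructor
    · intro h
      have hne := Γ.isTree.dist_ne_of_adj Γ.root h
      rcases lt_or_gt_of_ne hne with hlt | hlt
      · exact Or.inr (hPu w v ⟨h.symm, hlt⟩).symm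
      · exact Or.inl (hPu v w ⟨h, hlt⟩).symm
    · rintro (h | h)
      · rw [← h]
        exact (hP v).1
      · rw [← h]
        exact (hP w).1.symm
  · simp only [dite_eq_left_iff, reduceCtorEq, imp_false, not_not]
    constructor
    · intro h
      refine (hPu v Γ.root ⟨h.symm, ?_⟩).symm
      rw [SimpleGraph.dist_self]
      exact (Γ.isTree.connected.pos_dist_of_ne v.2.symm)
    · intro h
      have := (hP v).1
      rw [h] at this
      exact this.symm

section Energy

variable {Γ} {T : RootedForest Γ.Vert}

open scoped Classical in
theorem sum_adj_eq_parVal_add_childSum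
    (hT : ∀ v w, Γ.framedGraph.Adj v w ↔ T.par v = some w ∨ T.par w = some v)
    (x : Γ.Lattice) (v : Γ.Vert) :
    (∑ w, if Γ.framedGraph.Adj v w then x w else 0) = T.parVal 0 x v + T.childSum x v := by
  have hpar : T.parVal 0 x v = ∑ w, if T.par v = some w then x w else 0 := by
    unfold RootedForest.parVal
    cases T.par v with
    | none => simp
    | some p => simp
  rw [hpar, RootedForest.childSum, ← Finset.sum_add_distrib]
  refine Finset.sum_congr rfl fun w _ => ?_
  by_cases h1 : T.par v = some w
  · have h2 : T.par w ≠ some v := fun h2 => lt_asymm (T.depth_lt _ _ h1) (T.depth_lt _ _ h2)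
    simp [hT, h1, h2]
  · simp [hT, h1]

theorem inter_self_eq_sum
    (hT : ∀ v w, Γ.framedGraph.Adj v w ↔ T.par v = some w ∨ T.par w = some v) (x : Γ.Lattice) :
    Γ.inter x x = ∑ v, x v * (Γ.framing v * x v + (T.parVal 0 x v + T.childSum x v)) := by
  classical
  rw [inter, ← Finset.sum_add_distrib]
  refine Finset.sum_congr rfl fun v _ => ?_
  rw [mul_add, ← sum_adj_eq_parVal_add_childSum hT, Finset.mul_sum]
  congr 1
  · ring
  · exact Finset.sum_congr rfl fun w _ => by split_ifs <;> simp

theorem inter_self_eq_energy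
    (hT : ∀ v w, Γ.framedGraph.Adj v w ↔ T.par v = some w ∨ T.par w = some v) (x : Γ.Lattice) :
    Γ.inter x x = ∑ v, (Γ.framing v * x v * x v + 2 * (x v * T.parVal 0 x v)) := by
  have hswap : ∑ v, x v * T.childSum x v = ∑ v, x v * T.parVal 0 x v := by
    simp only [RootedForest.childSum, Finset.mul_sum]
    rw [Finset.sum_comm]
    refine Finset.sum_congr rfl fun w _ => ?_
    unfold RootedForest.parVal
    cases T.par w with
    | none => simp
    | some p => simp [mul_comm]
  have h1 : ∀ v, x v * (Γ.framing v * x v + (T.parVal 0 x v + T.childSum x v)) =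
      Γ.framing v * x v * x v + x v * T.parVal 0 x v + x v * T.childSum x v := fun v => by ring
  have h2 : ∀ v, Γ.framing v * x v * x v + 2 * (x v * T.parVal 0 x v) =
      Γ.framing v * x v * x v + x v * T.parVal 0 x v + x v * T.parVal 0 x v := fun v => by ring
  rw [inter_self_eq_sum hT]
  simp only [h1, h2]
  rw [Finset.sum_add_distrib, hswap, ← Finset.sum_add_distrib]

/-- The Riemann-Roch functions of a characteristic vector `k` and of `k + 2 v₀^*` are integer
valued energies, in which the value at the root `v₀` is `0` and `1` respectively. -/
theorem exists_chi_eq_energy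
    (hT : ∀ v w, Γ.framedGraph.Adj v w ↔ T.par v = some w ∨ T.par w = some v)
    (hroot : ∀ v : Γ.Vert, Γ.graph.Adj Γ.root v ↔ T.par v = none)
    {k : Γ.Cohomology} (hk : Γ.IsCharacteristic k) :
    ∃ (φ : Γ.Vert → ℤ → ℤ) (κ : Γ.Vert → ℤ),
      (∀ v n, φ v (n + 1) - φ v n = κ v - Γ.framing v * n) ∧
      (∀ x, Γ.chi k x = T.energy φ 0 x) ∧
      (∀ x, Γ.chi (k + 2 • Γ.rootDual) x = T.energy φ 1 x) := by
  classical
  have hkx : ∀ x : Γ.Lattice, k x = ∑ v, x v * k (Pi.single v 1) := by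
    intro x
    rw [LinearMap.pi_apply_eq_sum_univ k x]
    refine Finset.sum_congr rfl fun v _ => ?_
    rw [smul_eq_mul]
    congr 2
    ext w
    simp [Pi.single_apply, eq_comm]
  have hdiag : ∀ v : Γ.Vert, Γ.inter (Pi.single v 1) (Pi.single v 1) = Γ.framing v := by
    intro v
    rw [inter_self_eq_energy hT, Finset.sum_eq_single v]
    · have : T.parVal 0 (Pi.single v 1) v = 0 := by
        unfold RootedForest.parVal
        cases h : T.par v with
        | none => rfl
        | some p =>
          have hp : p ≠ v := fun h' => T.par_ne_self v (h' ▸ h)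
          simp [hp]
      simp [this]
    · intro w _ hw
      simp [hw]
    · simp
  have hparity : ∀ v : Γ.Vert, ∃ c, k (Pi.single v 1) + Γ.framing v = 2 * c := by
    intro v
    have h := hk (Pi.single v 1)
    rw [hdiag, Int.ModEq] at h
    exact ⟨(k (Pi.single v 1) + Γ.framing v) / 2, by omega⟩
  choose c hc using hparity
  have htwo : ∀ n : ℤ, 2 * (n * (n - 1) / 2) = n * (n - 1) := fun n =>
    Int.two_mul_ediv_two_of_even (Int.even_mul_pred_self n)
  let φ : Γ.Vert → ℤ → ℤ := fun v n => -(c v * n + Γ.framing v * (n * (n - 1) / 2))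
  have hφ2 : ∀ v n, 2 * φ v n = -(n * k (Pi.single v 1) + Γ.framing v * n * n) := by
    intro v n
    have h1 := htwo n
    have h2 := hc v
    simp only [φ]
    linear_combination (-Γ.framing v) * h1 + n * h2
  have h0 : ∀ x : Γ.Lattice, 2 * T.energy φ 0 x = -(k x + Γ.inter x x) := by
    intro x
    rw [hkx, inter_self_eq_energy hT, ← Finset.sum_add_distrib, ← Finset.sum_neg_distrib,
      RootedForest.energy, Finset.mul_sum]
    refine Finset.sum_congr rfl fun v _ => ?_
    linear_combination hφ2 v (x v)
  have hdual : ∀ x : Γ.Lattice, Γ.rootDual x = ∑ v, if T.par v = none then x v else 0 := by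
    intro x
    rw [rootDual, LinearMap.sum_apply]
    refine Finset.sum_congr rfl fun v _ => ?_
    by_cases h : T.par v = none
    · simp [hroot, h]
    · simp [hroot, h]
  have h1 : ∀ x : Γ.Lattice, T.energy φ 1 x = T.energy φ 0 x - Γ.rootDual x := by
    intro x
    rw [hdual, RootedForest.energy, RootedForest.energy, ← Finset.sum_sub_distrib]
    refine Finset.sum_congr rfl fun v _ => ?_
    unfold RootedForest.parVal
    cases T.par v with
    | none => simp
    | some p => simp
  refine ⟨φ, fun v => -c v, fun v n => ?_, fun x => ?_, fun x => ?_⟩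
  · have e1 := htwo (n + 1)
    have e2 := htwo n
    have e3 : 2 * (φ v (n + 1) - φ v n) = 2 * (-c v - Γ.framing v * n) := by
      simp only [φ]
      linear_combination (-Γ.framing v) * e1 + Γ.framing v * e2
    exact mul_left_cancel₀ two_ne_zero e3
  · have e : (2 : ℝ) * (T.energy φ 0 x : ℝ) = -((k x + Γ.inter x x : ℤ) : ℝ) := by
      exact_mod_cast h0 x
    rw [chi]
    linarith
  · have e : (2 : ℝ) * (T.energy φ 1 x : ℝ) =
        -(((k + 2 • Γ.rootDual) x + Γ.inter x x : ℤ) : ℝ) := by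
      have : 2 * T.energy φ 1 x = -((k + 2 • Γ.rootDual) x + Γ.inter x x) := by
        rw [h1]
        have := h0 x
        simp only [LinearMap.add_apply, LinearMap.smul_apply, nsmul_eq_mul]
        push_cast
        linarith
      exact_mod_cast this
    rw [chi]
    linarith

theorem weight_eq_cellMax {k : Γ.Cohomology} {f : Γ.Lattice → ℤ}
    (h : ∀ x, Γ.chi k x = f x) (c : Γ.Cell) : Γ.weight k c = cellMax f c := by
  obtain ⟨ℓ, I⟩ := c
  refine le_antisymm (Finset.sup'_le _ _ fun J hJ => ?_) ?_
  · rw [h]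
    exact_mod_cast le_cellMax f ℓ (Finset.mem_powerset.1 hJ)
  · obtain ⟨J, hJ, he⟩ := exists_eq_cellMax f ℓ I
    rw [he, ← h]
    exact Finset.le_sup' (fun J => Γ.chi k (Γ.corner ℓ J)) (Finset.mem_powerset.2 hJ)

end Energy

/-- At a vertex that is not bad, the number of adjacent vertices is at most minus the framing. -/
theorem parVal_add_childSum_le_of_not_isBad {T : RootedForest Γ.Vert}
    (hT : ∀ v w, Γ.framedGraph.Adj v w ↔ T.par v = some w ∨ T.par w = some v) {v : Γ.Vert}
    (hv : ¬Γ.IsBad v) : T.parVal 0 1 v + T.childSum 1 v ≤ -Γ.framing v := by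
  classical
  rw [IsBad, not_lt] at hv
  refine le_trans (le_of_eq ?_) hv
  rw [← sum_adj_eq_parVal_add_childSum hT]
  have : Γ.framedGraph.neighborSet v =
      ((Finset.univ.filter fun w => Γ.framedGraph.Adj v w : Finset Γ.Vert) : Set Γ.Vert) := by
    ext w
    simp
  rw [this, Set.ncard_coe_finset]
  simp

theorem NegativeDefinite.exists_one_le_le_neg_one (hneg : Γ.NegativeDefinite)
    {T : RootedForest Γ.Vert}
    (hT : ∀ v w, Γ.framedGraph.Adj v w ↔ T.par v = some w ∨ T.par w = some v) :
    ∃ q : Γ.Lattice, (∀ v, 1 ≤ q v) ∧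
      ∀ v, Γ.framing v * q v + T.parVal 0 q v + T.childSum q v ≤ -1 := by
  classical
  let M : Matrix Γ.Vert Γ.Vert ℤ := fun v w =>
    (if v = w then Γ.framing v else 0) + if Γ.framedGraph.Adj v w then 1 else 0
  have hM : ∀ (x : Γ.Lattice) v, M.mulVec x v =
      Γ.framing v * x v + (T.parVal 0 x v + T.childSum x v) := by
    intro x v
    rw [← sum_adj_eq_parVal_add_childSum hT]
    simp [M, Matrix.mulVec, dotProduct, add_mul, Finset.sum_add_distrib]
  have hoff : ∀ v w, v ≠ w → 0 ≤ M v w := fun v w hvw => by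
    simp only [M, hvw, if_false, zero_add]
    split_ifs <;> simp
  obtain ⟨q, hq, hMq⟩ := exists_one_le_mulVec_le_neg_one M hoff fun x hx => by
    have h := hneg x hx
    rw [inter_self_eq_sum hT] at h
    simpa only [dotProduct, hM] using h
  refine ⟨q, hq, fun v => ?_⟩
  have := hMq v
  rw [hM] at this
  omega

theorem boundary_eq_partialBoundary (z : Γ.Chain) : Γ.boundary z = partialBoundary ∅ z := by
  simp only [boundary, partialBoundary, Finset.sdiff_empty]

theorem mem_sublevelChains_iff {k : Γ.Cohomology} {t l : ℝ} {p : ℕ} {z : Γ.Chain} :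
    z ∈ Γ.sublevelChains k t l p ↔ SupportedOn {c | Γ.deformedWeight k t c ≤ l} p z := by
  rw [sublevelChains, Finsupp.mem_supported']
  refine forall_congr' fun x => ?_
  rw [not_imp_comm]
  exact imp_congr Iff.rfl and_comm

theorem reducedCycles_le_boundaries (hneg : Γ.NegativeDefinite) {t : ℝ}
    (ht : t ∈ Set.Icc (0 : ℝ) 2) {k : Γ.Cohomology} (hk : Γ.IsCharacteristic k) (l : ℝ) {p : ℕ}
    (hp : Γ.numBad ≤ p) : Γ.reducedCycles k t l p ≤ Γ.boundaries k t l p := by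
  classical
  obtain ⟨T, hT, hroot⟩ := Γ.exists_rootedForest
  obtain ⟨φ, κ, hφ, h0, h1⟩ := exists_chi_eq_energy hT hroot hk
  obtain ⟨q, hq, hqe⟩ := hneg.exists_one_le_le_neg_one Γ hT
  let B : Finset Γ.Vert := Finset.univ.filter fun v => Γ.IsBad v
  have hB : B.card = Γ.numBad := by
    rw [numBad, ← Set.ncard_coe_finset]
    simp [B]
  let ε : Bool → ℤ := fun j => if j then 1 else 0
  have hε : ∀ j, 0 ≤ ε j ∧ ε j ≤ 1 := fun j => by cases j <;> simp [ε]
  have hC : ∀ c c' : Γ.Cell,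
      (∀ j, cellMax (T.energy φ (ε j)) c' ≤ cellMax (T.energy φ (ε j)) c) →
      c ∈ {c | Γ.deformedWeight k t c ≤ l} → c' ∈ {c | Γ.deformedWeight k t c ≤ l} := by
    intro c c' h hc
    refine le_trans (add_le_add (mul_le_mul_of_nonneg_left ?_ (sub_nonneg.2 ht.2))
      (mul_le_mul_of_nonneg_left ?_ ht.1)) hc
    · rw [weight_eq_cellMax h0, weight_eq_cellMax h0]
      exact_mod_cast h false
    · rw [weight_eq_cellMax h1, weight_eq_cellMax h1]
      exact_mod_cast h true
  have hcol : ∀ D ⊆ B, ∀ a c : Γ.Lattice, a ≤ c → (∀ v ∈ B, a v = c v) →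
      ∃ b, c ≤ b ∧ (∀ v ∈ B, a v = b v) ∧
        BoxCollapse (fun j x => cellMax (T.energy φ (ε j)) (x, D)) a b := by
    intro D hD a c hac hacB
    exact T.exists_boxCollapse hφ hε hD (fun v hv =>
      Γ.parVal_add_childSum_le_of_not_isBad hT (by simpa [B] using hv)) hq hqe hac hacB
  have main : ∀ z : Γ.Chain, SupportedOn {c | Γ.deformedWeight k t c ≤ l} p z →
      partialBoundary ∅ z = 0 → (p = 0 → coeffSum z = 0) → z ∈ Γ.boundaries k t l p := by
    intro z hz hbz hz0
    obtain ⟨y, hy, hyz⟩ := exists_bounding_chain hC hcol (hB.trans_le hp) hz hbz hz0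
    exact ⟨y, Γ.mem_sublevelChains_iff.2 hy, (Γ.boundary_eq_partialBoundary y).trans hyz⟩
  intro z hz
  cases p with
  | zero =>
    have hz1 := Γ.mem_sublevelChains_iff.1 hz.1
    refine main z hz1 ?_ fun _ => hz.2
    -- a `0`-chain has no faces
    ext ⟨ℓ, K⟩
    by_contra h
    obtain ⟨v, hv, -, h | h⟩ := exists_coface_of_partialBoundary_ne_zero h
    · exact absurd (hz1 _ h).2 (by simp)
    · exact absurd (hz1 _ h).2 (by simp)
  | succ p =>
    refine main z (Γ.mem_sublevelChains_iff.1 hz.1) ?_ fun h => absurd h (Nat.succ_ne_zero p)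
    rw [← Γ.boundary_eq_partialBoundary]
    exact hz.2

end KnotPlumbing

theorem mainTheorem7 {V : Type*} [Fintype V] [DecidableEq V] (Γ : KnotPlumbing V)
    (hneg : Γ.NegativeDefinite) (n : ℕ) (hn : Γ.numBad ≤ n)
    (t : ℝ) (ht : t ∈ Set.Icc (0 : ℝ) 2)
    (k : Γ.Cohomology) (hk : Γ.IsCharacteristic k) (p : ℕ) (hp : n ≤ p) :
    Subsingleton (Γ.ReducedLatticeHomology k t p) := by
  have h : ∀ l, Subsingleton (Γ.ReducedHomology k t l p) := fun l => by
    rw [Submodule.Quotient.subsingleton_iff, Submodule.submoduleOf,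
      Submodule.comap_subtype_eq_top]
    exact Γ.reducedCycles_le_boundaries hneg ht hk l (hn.trans hp)
  exact Pi.instSubsingleton
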